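/- Let $d\ge 1$, let $e\in\mathbb{S}^d\subset\mathbb{R}^{d+1}$, and for every $n$ let $X_1,\dots,X_n$ be independent random points with the uniform distribution on the half-sphere $\{x\in\mathbb{S}^d:\langle x,e\rangle\ge 0\}$. The linear hyperplanes $X_1^\perp,\dots,X_n^\perp$ partition $\mathbb{R}^{d+1}$ into closed polyhedral cones (the closures of the connected components of the complement of their union). Let $S_n^{-e}$ be the almost surely unique one of these cones that contains $-e$. Almost surely, $S_n^{-e}=R_n^\circ$, where $R_n=\mathrm{pos}(X_1,\dots,X_n)$ is the convex cone generated by $X_1,\dots,X_n$ and $R_n^\circ=\{y:\langle x,y\rangle\le 0\text{ for all }x\in R_n\}$. Let $\mathrm{Tan}_{-e}=\{y\in\mathbb{R}^{d+1}:\langle -e,y+e\rangle=0\}$ be the affine tangent space of $\mathbb{S}^d$ at $-e$, let $I_{-e}:\mathrm{Tan}_{-e}\to\mathbb{R}^d$ be any isometry with $I_{-e}(-e)=0$, and put $P_n=n\,I_{-e}(S_n^{-e}\cap\mathrm{Tan}_{-e})\subset\mathbb{R}^d$. Let $\mathcal{K}^d$ be the space of non-empty compact convex subsets of $\mathbb{R}^d$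 with the Hausdorff metric, and let $P_n^*$ be a random element of $\mathcal{K}^d$ whose distribution is the conditional distribution of $P_n$ given the event $\{P_n\in\mathcal{K}^d\}$ (defined whenever this event has positive probability, in particular for all sufficiently large $n$). Let $\Pi$ be a Poisson point process on $\mathbb{R}^d\setminus\{0\}$ whose intensity measure has the density $g_d(y)=\frac{2}{\omega_{d+1}}\,\|y\|^{-(d+1)}$ with respect to the Lebesgue measure, where $\omega_{k}=2\pi^{k/2}/\Gamma(k/2)$. Let $\mathrm{conv}(\Pi)^\circ=\{y\in\mathbb{R}^d:\langle x,y\rangle\le 1\text{ for all }x\in\mathrm{conv}(\Pi)\}$. Then $\mathrm{conv}(\Pi)^\circ\in\mathcal{K}^d$ almost surely, all these objects are measurable (the events $\{P_n\in\mathcal{K}^d\}$ up to null sets, and the random sets, up to modification on null sets, as random elements of $\mathcal{K}^d$), and $$P_n^*\to\mathrm{conv}(\Pi)^\circ\qquad\text{as } n\to\infty,$$ weakly on $\mathcal{K}^d$: for every bounded continuous $h:\mathcal{K}^d\to\mathbb{R}$ one has $\mathbb{E}\,h(P_n^*)\to\mathbb{E}\,h(\mathrm{conv}(\Pi)^\circ)$.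 -/

import Mathlib

open MeasureTheory ProbabilityTheory Filter Topology
open scoped NNReal ENNReal Pointwise BoundedContinuousFunction

noncomputable section

namespace RandomCones

/-! ### The space of convex bodies and weak convergence on it -/

/-- `ConvexBody V` (the non-empty compact convex subsets of `V`, with Mathlib's Hausdorff metric)
carries the Borel sigma-algebra of the Hausdorff metric. -/
instance convexBodyMeasurableSpace {V : Type*} [NormedAddCommGroup V] [NormedSpace ℝ V] :
    MeasurableSpace (ConvexBody V) := borel (ConvexBody V)

instance convexBodyBorelSpace {V : Type*} [NormedAddCommGroup V] [NormedSpace ℝ V] :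
    BorelSpace (ConvexBody V) := ⟨rfl⟩

/-- The subset `K` is a member of the space of non-empty compact convex sets. -/
def IsBody {V : Type*} [NormedAddCommGroup V] [NormedSpace ℝ V] (K : Set V) : Prop :=
  Convex ℝ K ∧ IsCompact K ∧ K.Nonempty

open Classical in
/-- A non-empty compact convex set as a point of `ConvexBody V`. Other sets are sent to `{0}`; this
value is never used, as the map is applied only to random sets that are almost surely bodies. -/
def toBody {V : Type*} [NormedAddCommGroup V] [NormedSpace ℝ V] (K : Set V) : ConvexBody V :=
  if h : IsBody K then ⟨K, h.1, h.2.1, h.2.2⟩ else 0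

/-- Weak convergence of the measures `μ n` to `ν` as `n → ∞`: all but finitely many of the `μ n`,
and `ν`, are probability measures, and integrals of bounded continuous functions converge. -/
def ConvergesWeakly {S : Type*} [TopologicalSpace S] [MeasurableSpace S]
    (μ : ℕ → Measure S) (ν : Measure S) : Prop :=
  (∀ᶠ n in atTop, IsProbabilityMeasure (μ n)) ∧ IsProbabilityMeasure ν ∧
    ∀ h : S →ᵇ ℝ, Tendsto (fun n => ∫ x, h x ∂(μ n)) atTop (𝓝 (∫ x, h x ∂ν))

/-! ### Cones, hyperplane tessellations, profiles -/

/-- The polar cone `C° = {y : ⟨x, y⟩ ≤ 0 for all x ∈ C}`. -/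
def polarCone {V : Type*} [NormedAddCommGroup V] [InnerProductSpace ℝ V] (C : Set V) : Set V :=
  {y | ∀ x ∈ C, inner ℝ x y ≤ 0}

/-- The dual (polar) convex set `K° = {y : ⟨x, y⟩ ≤ 1 for all x ∈ K}`. -/
def polarSet {V : Type*} [NormedAddCommGroup V] [InnerProductSpace ℝ V] (K : Set V) : Set V :=
  {y | ∀ x ∈ K, inner ℝ x y ≤ 1}

/-- The union of the linear hyperplanes orthogonal to `x 1, …, x n`. -/
def hyperplaneUnion {V : Type*} [NormedAddCommGroup V] [InnerProductSpace ℝ V] {n : ℕ}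
    (x : Fin n → V) : Set V :=
  ⋃ i, {y | inner ℝ (x i) y = 0}

/-- The collection of closed cones into which the hyperplanes orthogonal to `x 1, …, x n`
partition the space: the closures of the connected components of the complement of their union. -/
def tessellation {V : Type*} [NormedAddCommGroup V] [InnerProductSpace ℝ V] {n : ℕ}
    (x : Fin n → V) : Set (Set V) :=
  {C | ∃ y ∈ (hyperplaneUnion x)ᶜ, C = closure (connectedComponentIn (hyperplaneUnion x)ᶜ y)}

/-- The affine hyperplane tangent at `v` to the unit sphere (`‖v‖ = 1`), as a subset of the
ambient space. -/
def tangentPlane {V : Type*} [NormedAddCommGroup V] [InnerProductSpace ℝ V] (v : V) : Set V :=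
  {y | inner ℝ v (y - v) = 0}

theorem self_mem_tangentPlane {V : Type*} [NormedAddCommGroup V] [InnerProductSpace ℝ V] (v : V) :
    v ∈ tangentPlane v := by
  simp [tangentPlane]

/-- The set `n • I (C ∩ Tan_v)`: the section of `C` by the tangent plane at `v`, transported by the
isometry `I` to `W`, and enlarged by the factor `n`. -/
def rescaledProfile {V W : Type*} [NormedAddCommGroup V] [InnerProductSpace ℝ V]
    [NormedAddCommGroup W] [InnerProductSpace ℝ W] {v : V} (n : ℕ)
    (I : tangentPlane v ≃ᵢ W) (C : Set V) : Set W :=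
  (n : ℝ) • (I '' {p : tangentPlane v | (p : V) ∈ C})

/-! ### The random objects -/

/-- The uniform distribution on the half-sphere `{x : ‖x‖ = 1, ⟨x, e⟩ ≥ 0}`: the surface measure of
the unit sphere, restricted to the half-sphere and normalized. -/
def halfSphereUniform {V : Type*} [NormedAddCommGroup V] [InnerProductSpace ℝ V]
    [FiniteDimensional ℝ V] [MeasurableSpace V] [BorelSpace V] (e : V) :
    Measure (Metric.sphere (0 : V) 1) :=
  ProbabilityTheory.cond (volume : Measure V).toSphere
    {x : Metric.sphere (0 : V) 1 | 0 ≤ inner ℝ (x : V) e}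

/-- The random countable set `N` is a Poisson point process with (diffuse) intensity measure `Λ`:
the number of points in a Borel set `B` is measurable, is Poisson distributed with mean `Λ B`
(infinite if `Λ B = ∞`), and the numbers of points in disjoint Borel sets are independent. -/
structure IsPoissonPointProcess {Ω S : Type*} [MeasurableSpace Ω] [MeasurableSpace S]
    (N : Ω → Set S) (Λ : Measure S) (P : Measure Ω) : Prop where
  countable : ∀ᵐ w ∂P, (N w).Countable
  aemeasurable : ∀ B : Set S, MeasurableSet B → AEMeasurable (fun w => (N w ∩ B).encard) P
  law : ∀ B : Set S, MeasurableSet B → Λ B ≠ ∞ → ∀ k : ℕ,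
    P {w | (N w ∩ B).encard = k} = poissonMeasure (Λ B).toNNReal {k}
  law_top : ∀ B : Set S, MeasurableSet B → Λ B = ∞ → ∀ᵐ w ∂P, (N w ∩ B).encard = ⊤
  indep : ∀ (k : ℕ) (B : Fin k → Set S), (∀ i, MeasurableSet (B i)) →
    Pairwise (fun i j => Disjoint (B i) (B j)) →
    iIndepFun (fun i w => (N w ∩ B i).encard) P

/-- The surface area `2 π ^ (k / 2) / Γ(k / 2)` of the unit sphere in dimension `k`. -/
def sphereArea (k : ℕ) : ℝ :=
  2 * Real.pi ^ ((k : ℝ) / 2) / Real.Gamma ((k : ℝ) / 2)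

/-- The measure on `ℝ^d` that is concentrated on `ℝ^d \ {0}` and has there the Lebesgue density
`y ↦ (2 / ω_{d+1}) / ‖y‖ ^ (d + 1)`. -/
def intensity (d : ℕ) : Measure (EuclideanSpace ℝ (Fin d)) :=
  (volume.restrict {0}ᶜ).withDensity
    (fun y => ENNReal.ofReal (2 / sphereArea (d + 1) * (1 / ‖y‖ ^ (d + 1))))

end RandomCones

end

/-!
Almost surely all `X i` lie in the open half-space of `e`, so `-e` is interior to the polar cone of
the `X i`, and this polar cone is the cell of `-e` (`tessellation_cell_eq_polarCone`). In the
tangent plane, the condition `⟨X i, -e + z⟩ ≤ 0` reads `⟨Y i, z⟩ ≤ 1`, where `Y i` is the gnomonic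
projection of `X i`. Hence the rescaled section is the polar set of the points `Y i / n`
(`rescaledProfile_polarCone_eq_polarSet`), to be compared with the polar set of the Poisson process.

Only the void probabilities of the two point sets matter. A polar set `A°` contains a finite set `J`
if and only if `A` has no point `x` with `⟨x, t⟩ > 1` for some `t ∈ J` (`subset_polarSet_iff`). For
a Borel set `B` away from the origin, the probability of finding no point in `B` is `exp (-Λ B)` for
the Poisson process with intensity `Λ` and `(1 - p) ^ n` for the sample. Fubini's theorem in the
coordinates `x = h e + A w` shows that `n p` is the integral over `B` of the function
`2 / ω_{d+1} (n / √(1 + n² ‖y‖²)) ^ (d + 1)`, which increases to the density of `Λ`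
(`toSphere_gnomonic_preimage`, `tendsto_mul_halfSphereUniform_gnomonic`). So the probabilities that
the random sets contain `J` converge.

A convex set `K` with `B(0, ρ) ⊆ K ⊆ B(0, M)` is, up to `δ (1 + M / ρ)` in the Hausdorff distance,
the convex hull of its trace on a finite `δ`-net `T` of the larger ball
(`dist_toBody_convexHull_le`). Every function of the trace of `K` on `T` is a linear combination of
the indicators of the events `J ⊆ K` with `J ⊆ T`, so its expectations converge. This yields the
measurability of the random bodies (`aemeasurable_toBody`) and the convergence of the expectations
of bounded Lipschitz functions (`convergesWeakly_toBody`), once `ρ` and `M` can be chosen uniformly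
in `n` outside an event of small probability. Void probabilities give this too: `B(0, ρ) ⊆ A°` if
`A` has no point of norm at least `1 / ρ`, and `A°` is bounded if `A` meets finitely many small
balls around the origin in sufficiently many directions (`real_not_isSqueezed_le`,
`exists_tight_radii`). In particular the probability of compactness tends to `1`, so that the
conditioning does not affect the limits (`tendsto_cond_real`).
-/

namespace RandomCones

/-! ### Polar sets and approximation of convex sets by points of a net -/

section Approximation

variable {W : Type*} [NormedAddCommGroup W] [InnerProductSpace ℝ W]

theorem polarSet_convexHull (A : Set W) : polarSet (convexHull ℝ A) = polarSet A := by
  refine Set.Subset.antisymm (fun y hy x hx => hy x (subset_convexHull ℝ A hx)) fun y hy => ?_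
  have hconv : Convex ℝ {x : W | inner ℝ x y ≤ 1} :=
    convex_halfSpace_le (IsLinearMap.mk (fun a b => inner_add_left a b y)
      (fun c a => by simp [inner_smul_left])) 1
  exact fun x hx => convexHull_min (fun x hx => hy x hx) hconv hx

theorem convex_polarSet (A : Set W) : Convex ℝ (polarSet A) := by
  have : polarSet A = ⋂ x ∈ A, {y | inner ℝ x y ≤ 1} := by ext; simp [polarSet]
  rw [this]
  exact convex_iInter₂ fun x _ => convex_halfSpace_le (IsLinearMap.mk
    (fun a b => inner_add_right x a b) (fun c a => by simp [inner_smul_right])) 1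

theorem isClosed_polarSet (A : Set W) : IsClosed (polarSet A) := by
  have : polarSet A = ⋂ x ∈ A, {y | inner ℝ x y ≤ 1} := by ext; simp [polarSet]
  rw [this]
  exact isClosed_biInter fun x _ => isClosed_le (by fun_prop) continuous_const

theorem closedBall_subset_polarSet {A : Set W} {R : ℝ} (hR : 0 < R) (hA : ∀ x ∈ A, ‖x‖ ≤ R) :
    Metric.closedBall 0 R⁻¹ ⊆ polarSet A := by
  intro y hy x hx
  rw [mem_closedBall_zero_iff] at hy
  calc inner ℝ x y ≤ ‖x‖ * ‖y‖ := real_inner_le_norm x y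
    _ ≤ R * R⁻¹ := by gcongr; exact hA x hx
    _ = 1 := mul_inv_cancel₀ hR.ne'

/-- If a set meets every ball `B(r u, r / 4)`, where `u` runs through a `1 / 4`-net of the unit
sphere, then in every direction it has a point at height at least `r / 2`. -/
theorem polarSet_subset_closedBall {A : Set W} {U : Set W} {r : ℝ} (hr : 0 < r)
    (hU : Metric.sphere (0 : W) 1 ⊆ ⋃ u ∈ U, Metric.ball u (1 / 4))
    (hA : ∀ u ∈ U, (A ∩ Metric.ball (r • u) (r / 4)).Nonempty) :
    polarSet A ⊆ Metric.closedBall 0 (2 / r) := by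
  intro y hy
  rw [mem_closedBall_zero_iff]
  rcases eq_or_ne y 0 with rfl | hy0
  · simpa using by positivity
  have hyn : 0 < ‖y‖ := norm_pos_iff.2 hy0
  set v : W := ‖y‖⁻¹ • y with hv
  have hv1 : ‖v‖ = 1 := by rw [hv, norm_smul, norm_inv, norm_norm, inv_mul_cancel₀ hyn.ne']
  obtain ⟨u, hu, huv⟩ := Set.mem_iUnion₂.1 (hU (mem_sphere_zero_iff_norm.2 hv1))
  obtain ⟨x, hxA, hxb⟩ := hA u hu
  rw [Metric.mem_ball, dist_eq_norm] at huv hxb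
  have h1 : ‖x - r • v‖ ≤ r / 2 := by
    have : x - r • v = (x - r • u) - r • (v - u) := by rw [smul_sub]; abel
    rw [this]
    calc ‖(x - r • u) - r • (v - u)‖ ≤ ‖x - r • u‖ + ‖r • (v - u)‖ := norm_sub_le _ _
      _ ≤ r / 4 + r * (1 / 4) := by
        rw [norm_smul, Real.norm_of_nonneg hr.le]; gcongr
      _ = r / 2 := by ring
  have h2 : r / 2 ≤ inner ℝ x v := by
    have e1 : inner ℝ x v = r + inner ℝ (x - r • v) v := by
      rw [inner_sub_left, inner_smul_left, real_inner_self_eq_norm_sq, hv1]; simp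
    have e2 := neg_le_of_abs_le (abs_real_inner_le_norm (x - r • v) v)
    rw [hv1, mul_one] at e2
    linarith
  have h3 : inner ℝ x y = ‖y‖ * inner ℝ x v := by
    rw [hv, inner_smul_right, ← mul_assoc, mul_inv_cancel₀ hyn.ne', one_mul]
  have h4 := hy x hxA
  rw [h3] at h4
  rw [le_div_iff₀ hr]
  nlinarith

theorem IsBody.polarSet [FiniteDimensional ℝ W] {A : Set W} {M : ℝ}
    (h : polarSet A ⊆ Metric.closedBall 0 M) : IsBody (polarSet A) :=
  ⟨convex_polarSet A, Metric.isCompact_of_isClosed_isBounded (isClosed_polarSet A)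
    (Metric.isBounded_closedBall.subset h), 0, fun x _ => by simp⟩

theorem coe_toBody {K : Set W} (h : IsBody K) : (toBody K : Set W) = K := by
  rw [toBody, dif_pos h]; rfl

theorem isBody_convexHull {s : Set W} (hs : s.Finite) (hne : s.Nonempty) :
    IsBody (convexHull ℝ s) :=
  ⟨convex_convexHull ℝ _, hs.isCompact_convexHull ℝ, hne.convexHull⟩

/-- A convex set squeezed between two balls is close to the convex hull of its intersection with
a `δ`-net of the larger ball: shrinking a point of the set by the factor `1 - δ / ρ` makes room for
a ball of radius `δ` in the set. -/
theorem dist_toBody_convexHull_le {K : Set W} (hK : IsBody K) {ρ M δ : ℝ}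
    (hδ : 0 < δ) (hδρ : δ ≤ ρ) (hρK : Metric.closedBall 0 ρ ⊆ K)
    (hKM : K ⊆ Metric.closedBall 0 M) {T : Set W} (hTf : T.Finite)
    (hT : Metric.closedBall 0 M ⊆ ⋃ t ∈ T, Metric.ball t δ) :
    dist (toBody K) (toBody (convexHull ℝ (T ∩ K))) ≤ δ * (1 + M / ρ) := by
  have hρ : 0 < ρ := hδ.trans_le hδρ
  have hq : δ / ρ ≤ 1 := (div_le_one hρ).2 hδρ
  have hq0 : 0 ≤ δ / ρ := by positivity
  have key : ∀ x ∈ K, ∃ t ∈ T ∩ K, dist x t ≤ δ * (1 + M / ρ) := by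
    intro x hx
    have hxM : ‖x‖ ≤ M := mem_closedBall_zero_iff.1 (hKM hx)
    have hM0 : 0 ≤ M := (norm_nonneg x).trans hxM
    have hp : ‖(1 - δ / ρ) • x‖ ≤ M := by
      rw [norm_smul, Real.norm_of_nonneg (by linarith)]
      nlinarith [norm_nonneg x]
    obtain ⟨t, htT, htd⟩ := Set.mem_iUnion₂.1 (hT (mem_closedBall_zero_iff.2 hp))
    rw [Metric.mem_ball, dist_eq_norm] at htd
    have hv : (ρ / δ) • (t - (1 - δ / ρ) • x) ∈ K := by
      refine hρK (mem_closedBall_zero_iff.2 ?_)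
      rw [norm_smul, norm_sub_rev, Real.norm_of_nonneg (by positivity)]
      calc ρ / δ * ‖(1 - δ / ρ) • x - t‖ ≤ ρ / δ * δ := by gcongr
        _ = ρ := div_mul_cancel₀ _ hδ.ne'
    have htK : t ∈ K := by
      have := hK.1 hx hv (sub_nonneg.2 hq) hq0 (by ring)
      rwa [smul_smul, div_mul_div_cancel₀ hρ.ne', div_self hδ.ne', one_smul,
        add_sub_cancel] at this
    refine ⟨t, ⟨htT, htK⟩, ?_⟩
    rw [dist_eq_norm]
    have : x - t = (δ / ρ) • x + ((1 - δ / ρ) • x - t) := by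
      rw [sub_smul, one_smul]; abel
    rw [this]
    calc ‖(δ / ρ) • x + ((1 - δ / ρ) • x - t)‖ ≤ ‖(δ / ρ) • x‖ + ‖(1 - δ / ρ) • x - t‖ :=
          norm_add_le _ _
      _ ≤ δ / ρ * M + δ := by
        rw [norm_smul, Real.norm_of_nonneg hq0]; gcongr
      _ = δ * (1 + M / ρ) := by ring
  have hsne : (T ∩ K).Nonempty := by
    obtain ⟨t, ht, -⟩ := key 0 (hρK (by simpa using hρ.le))
    exact ⟨t, ht⟩
  have hM0 : 0 ≤ M := by
    have := hKM (hρK (Metric.mem_closedBall_self hρ.le))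
    rw [mem_closedBall_zero_iff] at this
    exact (norm_nonneg _).trans this
  rw [← ConvexBody.hausdorffDist_coe, coe_toBody hK, coe_toBody (isBody_convexHull (hTf.inter_of_left K) hsne)]
  refine Metric.hausdorffDist_le_of_mem_dist (by positivity) (fun x hx => ?_) fun x hx => ?_
  · obtain ⟨t, ht, htd⟩ := key x hx
    exact ⟨t, subset_convexHull ℝ _ ht, htd⟩
  · refine ⟨x, convexHull_min (Set.inter_subset_right) hK.1 hx, ?_⟩
    rw [dist_self]; positivity

end Approximation

/-! ### The tessellation cell and its tangent section -/

section Cell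

variable {V : Type*} [NormedAddCommGroup V] [InnerProductSpace ℝ V]

theorem mem_polarCone_hull_range {n : ℕ} (x : Fin n → V) (y : V) :
    y ∈ polarCone (PointedCone.hull ℝ (Set.range x) : Set V) ↔ ∀ i, inner ℝ (x i) y ≤ 0 := by
  refine ⟨fun h i => h _ (Submodule.subset_span ⟨i, rfl⟩), fun h z hz => ?_⟩
  induction hz using Submodule.span_induction with
  | mem z hz => obtain ⟨i, rfl⟩ := hz; exact h i
  | zero => simp
  | add a b _ _ ha hb => rw [inner_add_left]; linarith
  | smul c a _ ha =>
    have : c • a = (c : ℝ) • a := rfl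
    rw [this, inner_smul_left]
    exact mul_nonpos_of_nonneg_of_nonpos (by simpa using c.2) ha

/-- If all `x i` lie in the open half-space of `e`, the cell that contains `-e` is the polar cone
of the `x i`, since `-e` is interior to this polar cone. -/
theorem tessellation_cell_eq_polarCone {n : ℕ} (x : Fin n → V) (e : V)
    (hx : ∀ i, 0 < inner ℝ (x i) e) {C : Set V} (hC : C ∈ tessellation x) (he : -e ∈ C) :
    C = polarCone (PointedCone.hull ℝ (Set.range x) : Set V) := by
  set U : Set V := {y | ∀ i, inner ℝ (x i) y < 0} with hUdef
  have hUo : IsOpen U := by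
    have : U = ⋂ i, {y | inner ℝ (x i) y < 0} := by ext; simp [hUdef]
    rw [this]
    exact isOpen_iInter_of_finite fun i => isOpen_lt (by fun_prop) continuous_const
  have hUc : Convex ℝ U := by
    have : U = ⋂ i, {y | inner ℝ (x i) y < 0} := by ext; simp [hUdef]
    rw [this]
    exact convex_iInter fun i => convex_halfSpace_lt (IsLinearMap.mk
      (fun a b => inner_add_right (x i) a b) (fun c a => by simp [inner_smul_right])) 0
  have hUsub : U ⊆ (hyperplaneUnion x)ᶜ := by
    intro y hy
    simp only [hyperplaneUnion, Set.mem_compl_iff, Set.mem_iUnion, not_exists]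
    exact fun i => (hy i).ne
  have heU : -e ∈ U := fun i => by rw [inner_neg_right]; linarith [hx i]
  obtain ⟨y, hy, rfl⟩ := hC
  obtain ⟨z, hzU, hzC⟩ := mem_closure_iff.1 he U hUo heU
  have hcomp : connectedComponentIn (hyperplaneUnion x)ᶜ y = U := by
    rw [connectedComponentIn_eq hzC]
    refine Set.Subset.antisymm (fun w hw i => ?_)
      (hUc.isPreconnected.subset_connectedComponentIn hzU hUsub)
    by_contra! hwi
    obtain ⟨q, hq, hq0⟩ := isPreconnected_connectedComponentIn.intermediate_value
      (mem_connectedComponentIn (hUsub hzU)) hw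
      (f := fun y => inner ℝ (x i) y) (by fun_prop) ⟨(hzU i).le, hwi⟩
    exact connectedComponentIn_subset _ _ hq (Set.mem_iUnion.2 ⟨i, hq0⟩)
  rw [hcomp]
  ext w
  rw [mem_polarCone_hull_range]
  constructor
  · intro hw i
    have hcl : IsClosed {y | inner ℝ (x i) y ≤ 0} := isClosed_le (by fun_prop) continuous_const
    exact closure_minimal (fun y hy => (hy i).le) hcl hw
  · intro hw
    have ht : Tendsto (fun t : ℝ => w + t • (-e)) (𝓝[>] 0) (𝓝 w) := by
      have : Tendsto (fun t : ℝ => w + t • (-e)) (𝓝 0) (𝓝 (w + (0 : ℝ) • (-e))) :=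
        Continuous.tendsto (by fun_prop) _
      rw [zero_smul, add_zero] at this
      exact this.mono_left nhdsWithin_le_nhds
    refine mem_closure_of_tendsto ht ?_
    filter_upwards [self_mem_nhdsWithin] with t ht i
    have ht' : 0 < t := ht
    rw [inner_add_right, inner_smul_right, inner_neg_right]
    nlinarith [hw i, hx i, mul_pos ht' (hx i)]

variable {W : Type*} [NormedAddCommGroup W] [InnerProductSpace ℝ W]

/-- An isometry of the tangent plane at `-e` that sends `-e` to the origin is the inverse of
`y ↦ -e + A y` for a linear isometry `A` into the orthogonal complement of `e`. -/
theorem exists_linearIsometry_of_tangentPlane {e : V}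
    (I : tangentPlane (-e) ≃ᵢ W) (hI : I ⟨-e, self_mem_tangentPlane (-e)⟩ = 0) :
    ∃ A : W →ₗᵢ[ℝ] V, (∀ y, (I.symm y : V) = -e + A y) ∧ ∀ y, inner ℝ e (A y) = 0 := by
  have hiso : Isometry fun y => (I.symm y : V) := isometry_subtype_coe.comp I.symm.isometry
  have h0 : (I.symm 0 : V) = -e := by rw [← hI, I.symm_apply_apply]
  have hA : ∀ y, (I.symm y : V) =
      -e + hiso.affineIsometryOfStrictConvexSpace.linearIsometry y := by
    intro y
    have := hiso.affineIsometryOfStrictConvexSpace.map_vadd 0 y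
    simp only [vadd_eq_add, add_zero, Isometry.affineIsometryOfStrictConvexSpace_apply, h0] at this
    rw [this, add_comm]
  refine ⟨_, hA, fun y => ?_⟩
  have h1 : inner ℝ (-e) ((I.symm y : V) - (-e)) = 0 := (I.symm y).2
  rw [hA y, inner_neg_left] at h1
  simpa using h1

theorem mem_rescaledProfile_iff {e : V} {I : tangentPlane (-e) ≃ᵢ W} {A : W →ₗᵢ[ℝ] V}
    (hA : ∀ y, (I.symm y : V) = -e + A y) {n : ℕ} (hn : n ≠ 0) (C : Set V) (y : W) :
    y ∈ rescaledProfile n I C ↔ -e + A ((n : ℝ)⁻¹ • y) ∈ C := by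
  have hn' : (n : ℝ) ≠ 0 := Nat.cast_ne_zero.2 hn
  rw [rescaledProfile, Set.mem_smul_set_iff_inv_smul_mem₀ hn']
  constructor
  · rintro ⟨p, hp, hpy⟩
    rw [← hpy, ← hA, I.symm_apply_apply]
    exact hp
  · intro h
    exact ⟨I.symm ((n : ℝ)⁻¹ • y), by rw [← hA] at h; exact h, I.apply_symm_apply _⟩

theorem rescaledProfile_zero {v : V} (I : tangentPlane v ≃ᵢ W) {C : Set V} (hv : v ∈ C) :
    rescaledProfile 0 I C = {0} := by
  rw [rescaledProfile, Nat.cast_zero, Set.zero_smul_set]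
  · rfl
  · exact ⟨_, ⟨v, self_mem_tangentPlane v⟩, hv, rfl⟩

variable [CompleteSpace V] [CompleteSpace W]

/-- The point `B x / (s ⟨x, e⟩)`, where `B` is the adjoint of the isometry `A` onto the orthogonal
complement of `e`: the gnomonic projection of `x`, divided by `s`. It is meaningful for
`⟨x, e⟩ ≠ 0`; on the equator the value is `0`. -/
noncomputable def gnomonic (e : V) (A : W →ₗᵢ[ℝ] V) (s : ℝ) (x : V) : W :=
  (s * inner ℝ x e)⁻¹ • ContinuousLinearMap.adjoint A.toContinuousLinearMap x

theorem inner_gnomonic (e : V) (A : W →ₗᵢ[ℝ] V) (s : ℝ) (x : V) (y : W) :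
    inner ℝ (gnomonic e A s x) y = (s * inner ℝ x e)⁻¹ * inner ℝ x (A y) := by
  rw [gnomonic, inner_smul_left, ContinuousLinearMap.adjoint_inner_left]
  simp

theorem rescaledProfile_polarCone_eq_polarSet {e : V} {I : tangentPlane (-e) ≃ᵢ W}
    {A : W →ₗᵢ[ℝ] V} (hA : ∀ y, (I.symm y : V) = -e + A y) {n : ℕ} (hn : n ≠ 0)
    (x : Fin n → V) (hx : ∀ i, 0 < inner ℝ (x i) e) :
    rescaledProfile n I (polarCone (PointedCone.hull ℝ (Set.range x) : Set V)) =
      polarSet (Set.range fun i => gnomonic e A n (x i)) := by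
  ext y
  rw [mem_rescaledProfile_iff hA hn, mem_polarCone_hull_range]
  simp only [polarSet, Set.mem_ofPred_eq, Set.forall_mem_range]
  refine forall_congr' fun i => ?_
  have hn' : (0 : ℝ) < n := by positivity
  rw [inner_gnomonic, inv_mul_le_iff₀ (mul_pos hn' (hx i)), inner_add_right, inner_neg_right,
    map_smul, inner_smul_right, mul_one, neg_add_le_iff_le_add, add_zero,
    inv_mul_le_iff₀ hn']

end Cell

end RandomCones

namespace RandomCones

/-! ### Random convex sets determined by their finite subsets -/

section RandomSets

variable {W : Type*}

/-- A function of the trace of a set on a finite set `T` is a linear combination of the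
indicators of the events that a given subset of `T` is contained in the set. -/
theorem exists_trace_expansion [DecidableEq W] (T : Finset W) (G : Set W → ℝ) :
    ∃ a : Finset W → ℝ, ∀ k : Set W,
      G (T ∩ k) = ∑ J ∈ T.powerset, a J * {k : Set W | (J : Set W) ⊆ k}.indicator 1 k := by
  classical
  induction T using Finset.induction_on generalizing G with
  | empty => exact ⟨fun _ => G ∅, fun k => by simp⟩
  | insert t T ht ih =>
    obtain ⟨a, ha⟩ := ih G
    obtain ⟨b, hb⟩ := ih fun s => G (insert t s) - G s
    refine ⟨fun J => if t ∈ J then b (J.erase t) else a J, fun k => ?_⟩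
    rw [Finset.sum_powerset_insert ht]
    have e1 : ∑ J ∈ T.powerset, (if t ∈ J then b (J.erase t) else a J) *
        {k : Set W | (J : Set W) ⊆ k}.indicator 1 k = G (T ∩ k) := by
      rw [ha]
      refine Finset.sum_congr rfl fun J hJ => ?_
      rw [if_neg fun h => ht (Finset.mem_powerset.1 hJ h)]
    have e2 : ∑ J ∈ T.powerset, (if t ∈ insert t J then b ((insert t J).erase t)
        else a (insert t J)) *
        {k : Set W | ((insert t J : Finset W) : Set W) ⊆ k}.indicator 1 k =
        if t ∈ k then G (insert t (T ∩ k)) - G (T ∩ k) else 0 := by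
      split_ifs with htk
      · rw [hb]
        refine Finset.sum_congr rfl fun J hJ => ?_
        rw [if_pos (Finset.mem_insert_self t J),
          Finset.erase_insert fun h => ht (Finset.mem_powerset.1 hJ h)]
        simp [Set.indicator_apply, Set.insert_subset_iff, htk]
      · refine Finset.sum_eq_zero fun J _ => ?_
        simp [Set.insert_subset_iff, htk]
    rw [e1, e2]
    split_ifs with htk
    · rw [Finset.coe_insert, Set.insert_inter_of_mem htk]; ring
    · rw [Finset.coe_insert, Set.insert_inter_of_notMem htk]; ring

variable {Ω : Type*} [MeasurableSpace Ω] {μ : Measure Ω} {K : Ω → Set W}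

theorem aemeasurable_trace {S : Type*} [MeasurableSpace S]
    (hm : ∀ t, NullMeasurableSet {w | t ∈ K w} μ) {T : Set W} (hT : T.Finite) (F : Set W → S) :
    AEMeasurable (fun w => F (T ∩ K w)) μ := by
  classical
  induction T, hT using Set.Finite.induction_on generalizing F with
  | empty => simp
  | @insert t T _ _ ih =>
    obtain ⟨f, hf, hfe⟩ := ih fun s => F (insert t s)
    obtain ⟨g, hg, hge⟩ := ih F
    obtain ⟨A, -, hA, hAe⟩ := (hm t).exists_measurable_superset_ae_eq
    refine ⟨fun w => if w ∈ A then f w else g w, hf.ite hA hg, ?_⟩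
    filter_upwards [hfe, hge, hAe.mem_iff] with w h1 h2 h3
    split_ifs with h
    · rw [Set.insert_inter_of_mem (h3.1 h), h1]
    · rw [Set.insert_inter_of_notMem fun h' => h (h3.2 h'), h2]

theorem nullMeasurableSet_finset_subset (hm : ∀ t, NullMeasurableSet {w | t ∈ K w} μ)
    (J : Finset W) : NullMeasurableSet {w | (J : Set W) ⊆ K w} μ := by
  have : {w | (J : Set W) ⊆ K w} = ⋂ t ∈ J, {w | t ∈ K w} := by
    ext; simp [Set.subset_def]
  rw [this]
  exact NullMeasurableSet.biInter (Finset.countable_toSet J) fun t _ => hm t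

theorem integral_trace_eq_sum [IsProbabilityMeasure μ] [DecidableEq W]
    (hm : ∀ t, NullMeasurableSet {w | t ∈ K w} μ) (T : Finset W) {G : Set W → ℝ}
    {a : Finset W → ℝ} (ha : ∀ k : Set W,
      G (T ∩ k) = ∑ J ∈ T.powerset, a J * {k : Set W | (J : Set W) ⊆ k}.indicator 1 k) :
    ∫ w, G (T ∩ K w) ∂μ = ∑ J ∈ T.powerset, a J * μ.real {w | (J : Set W) ⊆ K w} := by
  have hind : ∀ J : Finset W, (fun w => {k : Set W | (J : Set W) ⊆ k}.indicator (1 : Set W → ℝ)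
      (K w)) = {w | (J : Set W) ⊆ K w}.indicator 1 := fun J => rfl
  simp_rw [ha]
  rw [integral_finsetSum]
  · refine Finset.sum_congr rfl fun J _ => ?_
    rw [integral_const_mul, hind, integral_indicator₀ (nullMeasurableSet_finset_subset hm J)]
    simp
  · intro J _
    refine Integrable.const_mul ?_ _
    rw [hind]
    exact (integrable_const (1 : ℝ)).indicator₀ (nullMeasurableSet_finset_subset hm J)

variable [NormedAddCommGroup W] [InnerProductSpace ℝ W] [FiniteDimensional ℝ W]

/-- Compactness of a closed convex set with interior points is decided by its intersection with a
countable dense set, in which the interior points it contains are dense. -/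
theorem nullMeasurableSet_isBody (hm : ∀ t, NullMeasurableSet {w | t ∈ K w} μ)
    (hK : ∀ᵐ w ∂μ, Convex ℝ (K w) ∧ IsClosed (K w) ∧ K w ∈ 𝓝 0) :
    NullMeasurableSet {w | IsBody (K w)} μ := by
  obtain ⟨D, hDc, hD⟩ := TopologicalSpace.exists_countable_dense W
  have h1 : NullMeasurableSet
      (⋃ M : ℕ, ⋂ q ∈ D, ({w | q ∈ K w}ᶜ ∪ {_w | ‖q‖ ≤ M})) μ := by
    refine NullMeasurableSet.iUnion fun M => NullMeasurableSet.biInter hDc fun q _ => ?_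
    exact (hm q).compl.union (.const _)
  refine h1.congr ?_
  filter_upwards [hK] with w ⟨hc, hcl, h0⟩
  refine propext ?_
  change w ∈ (⋃ M : ℕ, ⋂ q ∈ D, ({w | q ∈ K w}ᶜ ∪ {_w | ‖q‖ ≤ M})) ↔ IsBody (K w)
  simp only [Set.mem_iUnion, Set.mem_iInter, Set.mem_union, Set.mem_compl_iff, Set.mem_ofPred_eq]
  constructor
  · rintro ⟨M, hM⟩
    have hsub : K w ⊆ Metric.closedBall 0 M := by
      have hi : (interior (K w)).Nonempty := ⟨0, mem_interior_iff_mem_nhds.2 h0⟩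
      calc K w ⊆ closure (K w) := subset_closure
        _ = closure (interior (K w)) := (hc.closure_interior_eq_closure_of_nonempty_interior hi).symm
        _ ⊆ closure (closure (interior (K w) ∩ D)) :=
          closure_mono (hD.open_subset_closure_inter isOpen_interior)
        _ = closure (interior (K w) ∩ D) := closure_closure
        _ ⊆ Metric.closedBall 0 M := by
          refine closure_minimal (fun q hq => ?_) Metric.isClosed_closedBall
          rw [mem_closedBall_zero_iff]
          exact (hM q hq.2).resolve_left fun h => h (interior_subset hq.1)
    exact ⟨hc, Metric.isCompact_of_isClosed_isBounded hcl
      (Metric.isBounded_closedBall.subset hsub), 0, mem_of_mem_nhds h0⟩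
  · rintro ⟨-, hcomp, -⟩
    obtain ⟨R, hR⟩ := hcomp.isBounded.subset_closedBall 0
    obtain ⟨M, hM⟩ := exists_nat_ge R
    refine ⟨M, fun q _ => or_iff_not_imp_left.2 fun hq => ?_⟩
    exact (mem_closedBall_zero_iff.1 (hR (not_not.1 hq))).trans hM

theorem exists_finite_net (M : ℝ) {δ : ℝ} (hδ : 0 < δ) :
    ∃ T : Set W, T.Finite ∧ Metric.closedBall 0 M ⊆ ⋃ t ∈ T, Metric.ball t δ := by
  obtain ⟨T, -, hT, hc⟩ := (isCompact_closedBall (0 : W) M).finite_cover_balls hδ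
  exact ⟨T, hT, hc⟩

theorem aemeasurable_toBody (hm : ∀ t, NullMeasurableSet {w | t ∈ K w} μ)
    (hK : ∀ᵐ w ∂μ, IsBody (K w) ∧ K w ∈ 𝓝 0) : AEMeasurable (fun w => toBody (K w)) μ := by
  choose T hTf hT using fun m : ℕ =>
    exists_finite_net (W := W) m (δ := 1 / ((m : ℝ) + 1)) (by positivity)
  refine aemeasurable_of_tendsto_metrizable_ae atTop
    (fun m => aemeasurable_trace hm (hTf m) fun s => toBody (convexHull ℝ s)) ?_
  filter_upwards [hK] with w ⟨hb, h0⟩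
  obtain ⟨ρ, hρ, hρK⟩ := Metric.nhds_basis_closedBall.mem_iff.1 h0
  obtain ⟨M, hM⟩ := hb.2.1.isBounded.subset_closedBall 0
  have hlim : Tendsto (fun m : ℕ => 1 / ((m : ℝ) + 1) * (1 + max M 0 / ρ)) atTop (𝓝 0) := by
    simpa using tendsto_one_div_add_atTop_nhds_zero_nat.mul_const (1 + max M 0 / ρ)
  rw [tendsto_iff_dist_tendsto_zero]
  refine squeeze_zero' (.of_forall fun _ => dist_nonneg) ?_ hlim
  filter_upwards [tendsto_one_div_add_atTop_nhds_zero_nat.eventually_le_const hρ,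
    tendsto_natCast_atTop_atTop.eventually_ge_atTop (max M 0)] with m h1 h2
  rw [dist_comm]
  refine dist_toBody_convexHull_le hb (by positivity) h1 hρK
    (hM.trans (Metric.closedBall_subset_closedBall (le_max_left M 0))) (hTf m) ?_
  exact (Metric.closedBall_subset_closedBall h2).trans (hT m)

/-- The set `K` lies between the balls of radii `ρ` and `M` about the origin. -/
def IsSqueezed (ρ M : ℝ) (K : Set W) : Prop :=
  Metric.closedBall 0 ρ ⊆ K ∧ K ⊆ Metric.closedBall 0 M

theorem abs_integral_toBody_sub_le [IsProbabilityMeasure μ]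
    (hm : ∀ t, NullMeasurableSet {w | t ∈ K w} μ)
    (hK : ∀ᵐ w ∂μ, IsBody (K w) ∧ K w ∈ 𝓝 0) {h : ConvexBody W → ℝ} {L : ℝ≥0} {C : ℝ}
    (hL : LipschitzWith L h) (hC : ∀ k, |h k| ≤ C) {ρ M δ : ℝ} (hδ : 0 < δ) (hδρ : δ ≤ ρ)
    (hM : 0 ≤ M) {T : Set W} (hTf : T.Finite)
    (hT : Metric.closedBall 0 M ⊆ ⋃ t ∈ T, Metric.ball t δ) :
    |∫ w, h (toBody (K w)) ∂μ - ∫ w, h (toBody (convexHull ℝ (T ∩ K w))) ∂μ| ≤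
      L * (δ * (1 + M / ρ)) + 2 * C * μ.real {w | ¬ IsSqueezed ρ M (K w)} := by
  have hC0 : 0 ≤ C := (abs_nonneg _).trans (hC 0)
  have hρ : 0 < ρ := hδ.trans_le hδρ
  have hi1 : Integrable (fun w => h (toBody (K w))) μ :=
    .of_bound (hL.continuous.measurable.comp_aemeasurable
      (aemeasurable_toBody hm hK)).aestronglyMeasurable C (.of_forall fun w => hC _)
  have hi2 : Integrable (fun w => h (toBody (convexHull ℝ (T ∩ K w)))) μ :=
    .of_bound (aemeasurable_trace hm hTf
      fun s => h (toBody (convexHull ℝ s))).aestronglyMeasurable C (.of_forall fun w => hC _)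
  set B := toMeasurable μ {w | ¬ IsSqueezed ρ M (K w)} with hB
  have hBm : MeasurableSet B := measurableSet_toMeasurable _ _
  rw [← integral_sub hi1 hi2]
  have hbound : ∀ᵐ w ∂μ, ‖h (toBody (K w)) - h (toBody (convexHull ℝ (T ∩ K w)))‖ ≤
      L * (δ * (1 + M / ρ)) + B.indicator (fun _ => 2 * C) w := by
    filter_upwards [hK] with w hw
    by_cases hsq : IsSqueezed ρ M (K w)
    · have h1 := hL.dist_le_mul (toBody (K w)) (toBody (convexHull ℝ (T ∩ K w)))
      have h2 := dist_toBody_convexHull_le hw.1 hδ hδρ hsq.1 hsq.2 hTf hT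
      have h3 : 0 ≤ B.indicator (fun _ => 2 * C) w :=
        Set.indicator_nonneg (fun _ _ => by positivity) w
      rw [← dist_eq_norm]
      calc _ ≤ _ := h1
        _ ≤ L * (δ * (1 + M / ρ)) := by gcongr
        _ ≤ _ := le_add_of_nonneg_right h3
    · have hwB : w ∈ B := subset_toMeasurable _ _ hsq
      rw [Set.indicator_of_mem hwB]
      have h3 : 0 ≤ L * (δ * (1 + M / ρ)) := by positivity
      calc _ ≤ _ := norm_sub_le _ _
        _ ≤ C + C := add_le_add (hC _) (hC _)
        _ ≤ _ := by linarith
  have hint : Integrable (fun w => L * (δ * (1 + M / ρ)) + B.indicator (fun _ => 2 * C) w) μ :=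
    (integrable_const _).add ((integrable_const _).indicator hBm)
  refine (norm_integral_le_of_norm_le hint hbound).trans_eq ?_
  rw [integral_add (integrable_const _) ((integrable_const _).indicator hBm),
    integral_indicator hBm]
  simp only [integral_const, probReal_univ, smul_eq_mul, one_mul, measureReal_restrict_apply_univ]
  rw [hB, measureReal_def, measure_toMeasurable, ← measureReal_def, mul_comm (2 * C)]

end RandomSets

theorem convergesWeakly_of_lipschitz {S : Type*} [PseudoMetricSpace S] [MeasurableSpace S]
    [BorelSpace S] {μ : ℕ → Measure S} {ν : Measure S}
    (hμ : ∀ᶠ n in atTop, IsProbabilityMeasure (μ n)) (hν : IsProbabilityMeasure ν)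
    (hlip : ∀ (h : S → ℝ) (L : ℝ≥0) (C : ℝ), LipschitzWith L h → (∀ x, |h x| ≤ C) →
      Tendsto (fun n => ∫ x, h x ∂(μ n)) atTop (𝓝 (∫ x, h x ∂ν))) :
    ConvergesWeakly μ ν := by
  classical
  refine ⟨hμ, hν, ?_⟩
  -- the finitely many `μ n` that are not probability measures are replaced by `ν`
  let ν' : ProbabilityMeasure S := ⟨ν, hν⟩
  let μ' : ℕ → ProbabilityMeasure S := fun n =>
    if h : IsProbabilityMeasure (μ n) then ⟨μ n, h⟩ else ν'
  have hμ' : ∀ᶠ n in atTop, (μ' n : Measure S) = μ n := by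
    filter_upwards [hμ] with n hn
    have : μ' n = ⟨μ n, hn⟩ := dif_pos hn
    rw [this]; rfl
  have key : Tendsto μ' atTop (𝓝 ν') := by
    rw [tendsto_iff_forall_lipschitz_integral_tendsto]
    rintro h ⟨C, hC⟩ ⟨L, hL⟩
    obtain ⟨x₀⟩ : Nonempty S := ν.nonempty_of_neZero
    refine (hlip h L (|h x₀| + C) hL fun x => ?_).congr' ?_
    · have h1 := hC x x₀
      rw [Real.dist_eq] at h1
      have h2 := abs_add_le (h x₀) (h x - h x₀)
      rw [add_sub_cancel] at h2
      linarith
    · filter_upwards [hμ'] with n hn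
      rw [hn]
  intro h
  refine ((ProbabilityMeasure.tendsto_iff_forall_integral_tendsto.1 key) h).congr' ?_
  filter_upwards [hμ'] with n hn
  rw [hn]

section Convergence

variable {W : Type*} [NormedAddCommGroup W] [InnerProductSpace ℝ W] [FiniteDimensional ℝ W]

/-- Random convex bodies converge in distribution as soon as the probabilities that they contain a
given finite set converge and they are, up to small probability, squeezed between two fixed
balls. -/
theorem convergesWeakly_toBody {Ω : ℕ → Type*} [∀ n, MeasurableSpace (Ω n)]
    {Q : ∀ n, Measure (Ω n)} {K : ∀ n, Ω n → Set W} {Ω' : Type*} [MeasurableSpace Ω']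
    {Q' : Measure Ω'} {K' : Ω' → Set W}
    (hQ : ∀ᶠ n in atTop, IsProbabilityMeasure (Q n)) (hQ' : IsProbabilityMeasure Q')
    (hm : ∀ᶠ n in atTop, ∀ t, NullMeasurableSet {w | t ∈ K n w} (Q n))
    (hm' : ∀ t, NullMeasurableSet {w | t ∈ K' w} Q')
    (hK : ∀ᶠ n in atTop, ∀ᵐ w ∂(Q n), IsBody (K n w) ∧ K n w ∈ 𝓝 0)
    (hK' : ∀ᵐ w ∂Q', IsBody (K' w) ∧ K' w ∈ 𝓝 0)
    (hlim : ∀ J : Finset W, Tendsto (fun n => (Q n).real {w | (J : Set W) ⊆ K n w}) atTop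
      (𝓝 (Q'.real {w | (J : Set W) ⊆ K' w})))
    (htight : ∀ ε : ℝ, 0 < ε → ∃ ρ M : ℝ, 0 < ρ ∧ 0 ≤ M ∧
      (∀ᶠ n in atTop, (Q n).real {w | ¬ IsSqueezed ρ M (K n w)} ≤ ε) ∧
      Q'.real {w | ¬ IsSqueezed ρ M (K' w)} ≤ ε) :
    ConvergesWeakly (fun n => (Q n).map fun w => toBody (K n w))
      (Q'.map fun w => toBody (K' w)) := by
  classical
  have hae' := aemeasurable_toBody hm' hK'
  refine convergesWeakly_of_lipschitz ?_ (Measure.isProbabilityMeasure_map hae') ?_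
  · filter_upwards [hQ, hm, hK] with n h1 h2 h3
    exact Measure.isProbabilityMeasure_map (aemeasurable_toBody h2 h3)
  intro h L C hL hC
  have hC0 : 0 ≤ C := (abs_nonneg _).trans (hC 0)
  rw [integral_map hae' hL.continuous.aestronglyMeasurable]
  have hmap : ∀ᶠ n in atTop, ∫ w, h (toBody (K n w)) ∂(Q n) =
      ∫ x, h x ∂((Q n).map fun w => toBody (K n w)) := by
    filter_upwards [hm, hK] with n h2 h3
    rw [integral_map (aemeasurable_toBody h2 h3) hL.continuous.aestronglyMeasurable]
  refine Tendsto.congr' hmap ?_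
  rw [Metric.tendsto_nhds]
  intro ε hε
  obtain ⟨ρ, M, hρ, hM, ht, ht'⟩ := htight (ε / (8 * (C + 1))) (by positivity)
  set δ := min ρ (ε / (8 * ((L : ℝ) + 1) * (1 + M / ρ))) with hδdef
  have hδ : 0 < δ := lt_min hρ (by positivity)
  have hδε : L * (δ * (1 + M / ρ)) ≤ ε / 8 := by
    have h1 : 0 < 1 + M / ρ := by positivity
    calc L * (δ * (1 + M / ρ)) ≤
        ((L : ℝ) + 1) * (ε / (8 * ((L : ℝ) + 1) * (1 + M / ρ)) * (1 + M / ρ)) := by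
          gcongr
          · linarith
          · exact min_le_right _ _
      _ = ε / 8 := by field_simp
  have hCε : 2 * C * (ε / (8 * (C + 1))) ≤ ε / 4 := by
    rw [mul_div_assoc', div_le_div_iff₀ (by positivity) (by norm_num)]
    nlinarith
  obtain ⟨T, hTf, hT⟩ := exists_finite_net (W := W) M hδ
  obtain ⟨T, rfl⟩ := hTf.exists_finset_coe
  obtain ⟨a, ha⟩ := exists_trace_expansion T fun s => h (toBody (convexHull ℝ s))
  have hfin : Tendsto (fun n => ∑ J ∈ T.powerset, a J * (Q n).real {w | (J : Set W) ⊆ K n w})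
      atTop (𝓝 (∑ J ∈ T.powerset, a J * Q'.real {w | (J : Set W) ⊆ K' w})) :=
    tendsto_finsetSum _ fun J _ => (hlim J).const_mul _
  have h0 := abs_integral_toBody_sub_le hm' hK' hL hC hδ (min_le_left _ _) hM hTf hT
  rw [integral_trace_eq_sum hm' T (G := fun s => h (toBody (convexHull ℝ s))) ha] at h0
  filter_upwards [hQ, hm, hK, ht, Metric.tendsto_nhds.1 hfin (ε / 8) (by positivity)]
    with n h1 h2 h3 h4 h5
  have h6 := abs_integral_toBody_sub_le h2 h3 hL hC hδ (min_le_left _ _) hM hTf hT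
  rw [integral_trace_eq_sum h2 T (G := fun s => h (toBody (convexHull ℝ s))) ha] at h6
  rw [Real.dist_eq] at h5 ⊢
  have h7 := mul_le_mul_of_nonneg_left h4 (show 0 ≤ 2 * C by positivity)
  have h8 := mul_le_mul_of_nonneg_left ht' (show 0 ≤ 2 * C by positivity)
  rw [abs_le] at h0 h6
  rw [abs_lt] at h5 ⊢
  constructor <;> linarith [h0.1, h0.2, h6.1, h6.2, h5.1, h5.2]

end Convergence

end RandomCones

namespace RandomCones

/-! ### The gnomonic projection of the uniform distribution on the half-sphere -/

section Gnomonic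

variable {V : Type*} [NormedAddCommGroup V] [InnerProductSpace ℝ V] [FiniteDimensional ℝ V]
  [MeasurableSpace V] [BorelSpace V]

theorem toSphere_apply_cone {C : Set V} (hC : MeasurableSet C)
    (hsmul : ∀ r : ℝ, 0 < r → ∀ x ∈ C, r • x ∈ C) :
    (volume : Measure V).toSphere {x | (x : V) ∈ C} =
      Module.finrank ℝ V * volume (C ∩ (Metric.ball 0 1 \ {0})) := by
  refine (Measure.toSphere_apply' _ (measurable_subtype_coe hC)).trans ?_
  congr 2
  ext v
  simp only [Set.mem_smul, Set.mem_image, Set.mem_inter_iff, Set.mem_sdiff, mem_ball_zero_iff,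
    Set.mem_singleton_iff]
  constructor
  · rintro ⟨r, hr, _, ⟨x, hx, rfl⟩, rfl⟩
    have hx1 : ‖(x : V)‖ = 1 := mem_sphere_zero_iff_norm.1 x.2
    refine ⟨hsmul r hr.1 _ hx, ?_, ?_⟩
    · rw [norm_smul, hx1, mul_one, Real.norm_of_nonneg hr.1.le]; exact hr.2
    · refine norm_ne_zero_iff.1 ?_
      rw [norm_smul, hx1, mul_one, Real.norm_of_nonneg hr.1.le]
      exact hr.1.ne'
  · rintro ⟨hv, hv1, hv0⟩
    have hn : 0 < ‖v‖ := norm_pos_iff.2 hv0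
    refine ⟨‖v‖, ⟨hn, hv1⟩, ‖v‖⁻¹ • v, ⟨⟨‖v‖⁻¹ • v, ?_⟩, hsmul _ (inv_pos.2 hn) _ hv, rfl⟩, ?_⟩
    · rw [mem_sphere_zero_iff_norm, norm_smul, norm_inv, norm_norm, inv_mul_cancel₀ hn.ne']
    · rw [smul_smul, mul_inv_cancel₀ hn.ne', one_smul]

theorem toSphere_equator {e : V} (he : e ≠ 0) :
    (volume : Measure V).toSphere {x | inner ℝ (x : V) e = 0} = 0 := by
  have hcl : MeasurableSet {x : V | inner ℝ x e = 0} :=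
    (isClosed_eq (by fun_prop) continuous_const).measurableSet
  have h := toSphere_apply_cone hcl fun r _ x hx => by
    have hx' : inner ℝ x e = 0 := hx
    rw [Set.mem_ofPred_eq, inner_smul_left, hx', mul_zero]
  have h0 : volume {x : V | inner ℝ x e = 0} = 0 := by
    have : {x : V | inner ℝ x e = 0} = ((ℝ ∙ e)ᗮ : Submodule ℝ V) := by
      ext x; simp [Submodule.mem_orthogonal_singleton_iff_inner_left]
    rw [this]
    refine Measure.addHaar_submodule _ _ fun htop => he ?_
    have : e ∈ (ℝ ∙ e)ᗮ := htop ▸ Submodule.mem_top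
    rw [Submodule.mem_orthogonal_singleton_iff_inner_left] at this
    exact inner_self_eq_zero.1 this
  exact h.trans (by rw [measure_mono_null Set.inter_subset_left h0, mul_zero])

theorem two_mul_toSphere_halfSphere {e : V} (he : e ≠ 0) :
    2 * (volume : Measure V).toSphere {x | 0 ≤ inner ℝ (x : V) e} =
      (volume : Measure V).toSphere Set.univ := by
  set σ := (volume : Measure V).toSphere with hσ
  have hcont : Continuous fun x : Metric.sphere (0 : V) 1 => inner ℝ (x : V) e := by fun_prop
  have hmeas : MeasurableSet {x : Metric.sphere (0 : V) 1 | 0 ≤ inner ℝ (x : V) e} :=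
    (isClosed_le continuous_const hcont).measurableSet
  have hle : σ {x : Metric.sphere (0 : V) 1 | 0 ≤ inner ℝ (x : V) e} =
      σ {x : Metric.sphere (0 : V) 1 | 0 < inner ℝ (x : V) e} := by
    refine measure_congr ?_
    have h0 : ∀ᵐ x : Metric.sphere (0 : V) 1 ∂σ, inner ℝ (x : V) e ≠ 0 := by
      rw [ae_iff]; simpa using toSphere_equator he
    filter_upwards [h0] with x hx
    exact propext ⟨fun h => lt_of_le_of_ne h hx.symm, fun h => le_of_lt h⟩
  have hpos := toSphere_apply_cone (V := V) (C := {x | 0 < inner ℝ x e})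
    (isOpen_lt continuous_const (by fun_prop)).measurableSet fun r hr x hx => by
      rw [Set.mem_ofPred_eq, inner_smul_left]; exact mul_pos hr hx
  have hneg := toSphere_apply_cone (V := V) (C := {x | inner ℝ x e < 0})
    (isOpen_lt (by fun_prop) continuous_const).measurableSet fun r hr x hx => by
      rw [Set.mem_ofPred_eq, inner_smul_left]; exact mul_neg_of_pos_of_neg hr hx
  have hsymm : σ {x : Metric.sphere (0 : V) 1 | inner ℝ (x : V) e < 0} =
      σ {x : Metric.sphere (0 : V) 1 | 0 < inner ℝ (x : V) e} := by
    refine hneg.trans (Eq.trans ?_ hpos.symm)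
    rw [← Measure.measure_preimage_neg]
    congr 2
    ext x
    simp
  have hc : σ {x : Metric.sphere (0 : V) 1 | 0 ≤ inner ℝ (x : V) e}ᶜ =
      σ {x : Metric.sphere (0 : V) 1 | inner ℝ (x : V) e < 0} := by
    congr 1
    ext x
    simp
  rw [← measure_add_measure_compl hmeas, hc, hsymm, ← hle, two_mul]

section Coordinates

variable {V W : Type*} [NormedAddCommGroup V] [InnerProductSpace ℝ V] [NormedAddCommGroup W]
  [InnerProductSpace ℝ W]

theorem norm_smul_add_sq {e : V} (he : ‖e‖ = 1) {A : W →ₗᵢ[ℝ] V}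
    (hA : ∀ y, inner ℝ e (A y) = 0) (h : ℝ) (w : W) :
    ‖h • e + A w‖ ^ 2 = h ^ 2 + ‖w‖ ^ 2 := by
  rw [norm_add_sq_real, inner_smul_left, hA, norm_smul, he, A.norm_map]
  simp

theorem gnomonic_smul_add [CompleteSpace V] [CompleteSpace W] {e : V} (he : ‖e‖ = 1) {A : W →ₗᵢ[ℝ] V}
    (hA : ∀ y, inner ℝ e (A y) = 0) (s h : ℝ) (w : W) :
    gnomonic e A s (h • e + A w) = (s * h)⁻¹ • w := by
  have h1 : ContinuousLinearMap.adjoint A.toContinuousLinearMap (h • e + A w) = w := by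
    refine ext_inner_right ℝ fun y => ?_
    rw [ContinuousLinearMap.adjoint_inner_left, inner_add_left, inner_smul_left]
    simp [hA]
  have h2 : inner ℝ (h • e + A w) e = h := by
    rw [inner_add_left, inner_smul_left, real_inner_comm, real_inner_self_eq_norm_sq, he,
      ← real_inner_comm, hA]
    simp
  rw [gnomonic, h1, h2]

end Coordinates

variable {W : Type*} [NormedAddCommGroup W] [InnerProductSpace ℝ W] [FiniteDimensional ℝ W]
  [MeasurableSpace W] [BorelSpace W]

/-- The orthogonal decomposition of a space into the line of `e` and its complement preserves the
volume. -/
theorem measurePreserving_smul_add {e : V} (he : ‖e‖ = 1) {A : W →ₗᵢ[ℝ] V}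
    (hA : ∀ y, inner ℝ e (A y) = 0) (hdim : Module.finrank ℝ V = Module.finrank ℝ W + 1) :
    MeasurePreserving fun p : ℝ × W => p.1 • e + A p.2 := by
  let f : WithLp 2 (ℝ × W) →ₗ[ℝ] V :=
    { toFun := fun p => p.fst • e + A p.snd
      map_add' := fun p q => by simp [add_smul]; abel
      map_smul' := fun c p => by simp [mul_smul] }
  let F : WithLp 2 (ℝ × W) →ₗᵢ[ℝ] V :=
    { f with
      norm_map' := fun p => by
        have h1 : ‖f p‖ ^ 2 = ‖p‖ ^ 2 := by
          rw [WithLp.prod_norm_sq_eq_of_L2, Real.norm_eq_abs, sq_abs]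
          exact norm_smul_add_sq he hA _ _
        exact (pow_left_inj₀ (norm_nonneg _) (norm_nonneg _) two_ne_zero).1 h1 }
  have hfin : Module.finrank ℝ (WithLp 2 (ℝ × W)) = Module.finrank ℝ V := by
    rw [(WithLp.linearEquiv 2 ℝ (ℝ × W)).finrank_eq, Module.finrank_prod, hdim,
      Module.finrank_self, add_comm]
  exact (F.toLinearIsometryEquiv hfin).measurePreserving.comp (WithLp.volume_preserving_toLp ℝ W)

theorem lintegral_pow_mul_indicator (d : ℕ) {s q : ℝ} (hs : 0 ≤ s) (hq : 0 < q) :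
    ∫⁻ h in Set.Ioi (0 : ℝ), ENNReal.ofReal ((s * h) ^ d) *
      {h : ℝ | h * q < 1}.indicator 1 h =
      ENNReal.ofReal (s ^ d / q ^ (d + 1) / (d + 1)) := by
  have hset : MeasurableSet {h : ℝ | h * q < 1} :=
    (isOpen_lt (by fun_prop) continuous_const).measurableSet
  have h1 : ∀ h : ℝ, ENNReal.ofReal ((s * h) ^ d) * {h : ℝ | h * q < 1}.indicator 1 h =
      {h : ℝ | h * q < 1}.indicator (fun h => ENNReal.ofReal ((s * h) ^ d)) h := fun h => by
    simp [Set.indicator_apply]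
  have hI : {h : ℝ | h * q < 1} ∩ Set.Ioi 0 = Set.Ioo 0 (1 / q) := by
    ext h
    simp only [Set.mem_inter_iff, Set.mem_ofPred_eq, Set.mem_Ioi, Set.mem_Ioo, lt_div_iff₀ hq]
    tauto
  have hint : IntegrableOn (fun h : ℝ => (s * h) ^ d) (Set.Ioc 0 (1 / q)) :=
    (Continuous.intervalIntegrable (by fun_prop) 0 (1 / q)).1
  simp_rw [h1]
  rw [lintegral_indicator hset, Measure.restrict_restrict hset, hI,
    Measure.restrict_congr_set Ioo_ae_eq_Ioc, ← ofReal_integral_eq_lintegral_ofReal hint]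
  · rw [← intervalIntegral.integral_of_le (by positivity)]
    simp_rw [mul_pow]
    rw [intervalIntegral.integral_const_mul, integral_pow]
    congr 1
    have := hq.ne'
    rw [zero_pow (Nat.succ_ne_zero d), sub_zero, one_div, inv_pow]
    field_simp
  · filter_upwards [ae_restrict_mem measurableSet_Ioc] with h hh
    have := hh.1.le
    positivity

theorem measurable_gnomonic (e : V) (A : W →ₗᵢ[ℝ] V) (s : ℝ) :
    Measurable (gnomonic e A s) := by
  unfold gnomonic
  fun_prop

/-- In the coordinates `x = h e + A w` the cone over a set of the half-sphere is described by
`w = s h y` with `h > 0` and `y` in the gnomonic image, and Fubini's theorem gives the density of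
the gnomonic projection of the surface measure. -/
theorem toSphere_gnomonic_preimage {e : V} (he : ‖e‖ = 1) {A : W →ₗᵢ[ℝ] V}
    (hA : ∀ y, inner ℝ e (A y) = 0) {d : ℕ} (hW : Module.finrank ℝ W = d)
    (hV : Module.finrank ℝ V = d + 1) {s : ℝ} (hs : 0 < s) {B : Set W} (hB : MeasurableSet B) :
    (volume : Measure V).toSphere {x | 0 < inner ℝ (x : V) e ∧ gnomonic e A s (x : V) ∈ B} =
      ∫⁻ y in B, ENNReal.ofReal (s ^ d / √(1 + s ^ 2 * ‖y‖ ^ 2) ^ (d + 1)) := by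
  set C : Set V := {x | 0 < inner ℝ x e ∧ gnomonic e A s x ∈ B} with hC
  have hCe : MeasurableSet {x : V | 0 < inner ℝ x e} :=
    (isOpen_lt continuous_const (by fun_prop)).measurableSet
  have hCm : MeasurableSet C := hCe.inter (measurable_gnomonic e A s hB)
  have hcone := toSphere_apply_cone hCm fun r hr x hx => by
    refine ⟨?_, ?_⟩
    · rw [inner_smul_left]; exact mul_pos hr hx.1
    · have : gnomonic e A s (r • x) = gnomonic e A s x := by
        rw [gnomonic, gnomonic, inner_smul_left, map_smul, smul_smul]
        have := hx.1.ne'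
        congr 1
        simp only [conj_trivial]
        field_simp
      rw [this]; exact hx.2
  refine hcone.trans ?_
  set q : W → ℝ := fun y => √(1 + s ^ 2 * ‖y‖ ^ 2) with hq
  have hq0 : ∀ y, 0 < q y := fun y => Real.sqrt_pos.2 (by positivity)
  have hqc : Continuous q := by fun_prop
  have hmp := measurePreserving_smul_add he hA (hV.trans (by rw [hW]))
  have hCm' : MeasurableSet (C ∩ (Metric.ball 0 1 \ {0})) :=
    hCm.inter (measurableSet_ball.diff (measurableSet_singleton 0))
  -- in coordinates, the slice at height `h > 0` is the dilation by `s h` of a subset of `B`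
  have hslice : ∀ h : ℝ, volume (Prod.mk h ⁻¹' ((fun p : ℝ × W => p.1 • e + A p.2) ⁻¹'
      (C ∩ (Metric.ball 0 1 \ {0})))) = (Set.Ioi 0).indicator
        (fun h => ∫⁻ y in B, ENNReal.ofReal ((s * h) ^ d) *
          {h : ℝ | h * q y < 1}.indicator 1 h) h := by
    intro h
    have hinner : ∀ w, inner ℝ (h • e + A w) e = h := fun w => by
      rw [inner_add_left, inner_smul_left, real_inner_comm, real_inner_self_eq_norm_sq, he,
        ← real_inner_comm, hA]
      simp
    by_cases hh : 0 < h
    · rw [Set.indicator_of_mem (Set.mem_Ioi.2 hh)]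
      have hsh : 0 < s * h := mul_pos hs hh
      have hBq : MeasurableSet {y | h * q y < 1} :=
        (isOpen_lt (by fun_prop) continuous_const).measurableSet
      have hset : Prod.mk h ⁻¹' ((fun p : ℝ × W => p.1 • e + A p.2) ⁻¹'
          (C ∩ (Metric.ball 0 1 \ {0}))) = (s * h) • ({y | h * q y < 1} ∩ B) := by
        ext w
        rw [Set.mem_smul_set_iff_inv_smul_mem₀ hsh.ne']
        have hw : ‖h • e + A w‖ < 1 ↔ h * q ((s * h)⁻¹ • w) < 1 := by
          have h1 : h * q ((s * h)⁻¹ • w) = ‖h • e + A w‖ := by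
            refine (pow_left_inj₀ (mul_nonneg hh.le (hq0 _).le) (norm_nonneg _) two_ne_zero).1 ?_
            rw [norm_smul_add_sq he hA, mul_pow, hq, Real.sq_sqrt (by positivity), norm_smul,
              Real.norm_of_nonneg (by positivity)]
            field_simp
          rw [h1]
        have hw0 : h • e + A w ≠ 0 := fun h0 => by
          have := hinner w
          rw [h0, inner_zero_left] at this
          exact hh.ne this
        simp only [hC, Set.mem_preimage, Set.mem_inter_iff, Set.mem_ofPred_eq, hinner,
          gnomonic_smul_add he hA, Set.mem_sdiff, mem_ball_zero_iff, hw, Set.mem_singleton_iff,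
          hw0, not_false_eq_true, and_true, hh, true_and]
        tauto
      have hind : ∀ y, ENNReal.ofReal ((s * h) ^ d) *
          {h : ℝ | h * q y < 1}.indicator (1 : ℝ → ℝ≥0∞) h =
          ENNReal.ofReal ((s * h) ^ d) * {y | h * q y < 1}.indicator 1 y := fun y => rfl
      rw [hset, Measure.addHaar_smul, hW, abs_of_pos (by positivity)]
      simp_rw [hind]
      rw [lintegral_const_mul _ (measurable_one.indicator hBq), lintegral_indicator_one hBq,
        Measure.restrict_apply hBq]
    · rw [Set.indicator_of_notMem (by simpa using hh)]
      refine measure_mono_null (t := ∅) (fun w hw => hh ?_) measure_empty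
      have := hw.1.1
      rwa [hinner] at this
  have hmeas : Measurable (Function.uncurry fun (h : ℝ) (y : W) =>
      ENNReal.ofReal ((s * h) ^ d) * {h : ℝ | h * q y < 1}.indicator (1 : ℝ → ℝ≥0∞) h) := by
    have hS : MeasurableSet {p : ℝ × W | p.1 * q p.2 < 1} :=
      (isOpen_lt (by fun_prop) continuous_const).measurableSet
    have : (Function.uncurry fun (h : ℝ) (y : W) =>
        ENNReal.ofReal ((s * h) ^ d) * {h : ℝ | h * q y < 1}.indicator (1 : ℝ → ℝ≥0∞) h) =
        fun p : ℝ × W => ENNReal.ofReal ((s * p.1) ^ d) *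
          {p : ℝ × W | p.1 * q p.2 < 1}.indicator 1 p := rfl
    rw [this]
    exact Measurable.mul (by fun_prop) (measurable_one.indicator hS)
  rw [← hmp.measure_preimage hCm'.nullMeasurableSet, Measure.volume_eq_prod,
    Measure.prod_apply (hmp.measurable hCm')]
  simp_rw [hslice]
  rw [lintegral_indicator measurableSet_Ioi, lintegral_lintegral_swap hmeas.aemeasurable]
  simp_rw [lintegral_pow_mul_indicator d hs.le (hq0 _)]
  rw [hV, ← lintegral_const_mul _ (by fun_prop)]
  refine lintegral_congr fun y => ?_
  rw [← ENNReal.ofReal_natCast, ← ENNReal.ofReal_mul (by positivity)]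
  congr 1
  have hqy : √(1 + s ^ 2 * ‖y‖ ^ 2) = q y := rfl
  have := (hq0 y).ne'
  rw [hqy]
  push_cast
  field_simp

end Gnomonic

end RandomCones

namespace RandomCones

/-! ### The intensity measure and the rescaled gnomonic projections -/

section Intensity

theorem sphereArea_pos {k : ℕ} (hk : 0 < k) : 0 < sphereArea k := by
  have : (0 : ℝ) < k := by exact_mod_cast hk
  have := Real.Gamma_pos_of_pos (half_pos this)
  unfold sphereArea
  positivity

theorem toSphere_univ_eq_sphereArea (k : ℕ) :
    (volume : Measure (EuclideanSpace ℝ (Fin (k + 1)))).toSphere Set.univ =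
      ENNReal.ofReal (sphereArea (k + 1)) := by
  have hk : (0 : ℝ) < (k + 1 : ℕ) / 2 := by positivity
  have hΓ := (Real.Gamma_pos_of_pos hk).ne'
  rw [Measure.toSphere_apply_univ, EuclideanSpace.volume_ball, finrank_euclideanSpace,
    Fintype.card_fin, ENNReal.ofReal_one, one_pow, one_mul, ← ENNReal.ofReal_natCast,
    ← ENNReal.ofReal_mul (by positivity), Real.Gamma_add_one hk.ne', sphereArea,
    Real.sqrt_eq_rpow, ← Real.rpow_mul_natCast Real.pi_pos.le]
  congr 1
  rw [one_div_mul_eq_div]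
  field_simp

/-- Since `1 / 0 = 0`, the density formula vanishes at the origin, and the restriction to the
complement of the origin can be dropped. -/
theorem intensity_apply {d : ℕ} {B : Set (EuclideanSpace ℝ (Fin d))} (hB : MeasurableSet B) :
    intensity d B =
      ∫⁻ y in B, ENNReal.ofReal (2 / sphereArea (d + 1) * (1 / ‖y‖ ^ (d + 1))) := by
  rw [intensity, withDensity_apply _ hB, Measure.restrict_restrict hB,
    ← lintegral_indicator (hB.inter (measurableSet_singleton 0).compl), ← lintegral_indicator hB]
  refine lintegral_congr fun y => ?_
  by_cases hyB : y ∈ B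
  · rcases eq_or_ne y 0 with rfl | hy
    · simp [hyB]
    · simp [hyB, hy]
  · simp [hyB]

/-- The density decays like `‖y‖ ^ (-(d + 1))`, so only the neighbourhoods of the origin have
infinite mass. -/
theorem intensity_lt_top {d : ℕ} {ε : ℝ} (hε : 0 < ε) :
    intensity d {y | ε ≤ ‖y‖} < ∞ := by
  have hm : MeasurableSet {y : EuclideanSpace ℝ (Fin d) | ε ≤ ‖y‖} :=
    (isClosed_le continuous_const continuous_norm).measurableSet
  have hA := sphereArea_pos (Nat.succ_pos d)
  rw [intensity_apply hm]
  set c : ℝ := 2 / sphereArea (d + 1) * (1 + 1 / ε) ^ (d + 1) with hc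
  have hfin : (∫⁻ y : EuclideanSpace ℝ (Fin d),
      ENNReal.ofReal ((1 + ‖y‖) ^ (-((d : ℝ) + 1)))) < ∞ :=
    finite_integral_one_add_norm (by simp)
  calc ∫⁻ y in {y : EuclideanSpace ℝ (Fin d) | ε ≤ ‖y‖},
        ENNReal.ofReal (2 / sphereArea (d + 1) * (1 / ‖y‖ ^ (d + 1)))
      ≤ ∫⁻ y in {y : EuclideanSpace ℝ (Fin d) | ε ≤ ‖y‖},
        ENNReal.ofReal c * ENNReal.ofReal ((1 + ‖y‖) ^ (-((d : ℝ) + 1))) := by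
        refine setLIntegral_mono' hm fun y hy => ?_
        have hy' : ε ≤ ‖y‖ := hy
        have hy0 : 0 < ‖y‖ := hε.trans_le hy'
        rw [← ENNReal.ofReal_mul (by positivity)]
        refine ENNReal.ofReal_le_ofReal ?_
        have h1 : ((1 : ℝ) + ‖y‖) ^ (-((d : ℝ) + 1)) = 1 / (1 + ‖y‖) ^ (d + 1) := by
          rw [Real.rpow_neg (by positivity), one_div]
          congr 1
          exact_mod_cast Real.rpow_natCast (1 + ‖y‖) (d + 1)
        have h2 : 1 + ‖y‖ ≤ (1 + 1 / ε) * ‖y‖ := by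
          have : 1 ≤ 1 / ε * ‖y‖ := by rw [one_div_mul_eq_div, one_le_div hε]; exact hy'
          linarith
        rw [h1, hc, mul_assoc]
        gcongr
        rw [mul_one_div, div_le_div_iff₀ (by positivity) (by positivity), one_mul, ← mul_pow]
        gcongr
    _ ≤ ∫⁻ y : EuclideanSpace ℝ (Fin d),
        ENNReal.ofReal c * ENNReal.ofReal ((1 + ‖y‖) ^ (-((d : ℝ) + 1))) :=
        setLIntegral_le_lintegral _ _
    _ < ∞ := by
        rw [lintegral_const_mul _ (by fun_prop)]
        exact ENNReal.mul_lt_top ENNReal.ofReal_lt_top hfin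

theorem intensity_smul {d : ℕ} {r : ℝ} (hr : 0 < r) {B : Set (EuclideanSpace ℝ (Fin d))}
    (hB : MeasurableSet B) : intensity d (r • B) = ENNReal.ofReal r⁻¹ * intensity d B := by
  set f : EuclideanSpace ℝ (Fin d) → ℝ≥0∞ :=
    fun y => ENNReal.ofReal (2 / sphereArea (d + 1) * (1 / ‖y‖ ^ (d + 1))) with hf
  have hfm : Measurable f := by fun_prop
  have hrB : MeasurableSet (r • B) := hB.const_smul₀ r
  have hpre : (fun y : EuclideanSpace ℝ (Fin d) => r • y) ⁻¹' (r • B) = B := by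
    rw [Set.preimage_smul₀ hr.ne', inv_smul_smul₀ hr.ne']
  have hmap := Measure.map_addHaar_smul (volume : Measure (EuclideanSpace ℝ (Fin d))) hr.ne'
  have hchange : ∫⁻ y in B, f (r • y) =
      ENNReal.ofReal (r ^ d)⁻¹ * ∫⁻ y in r • B, f y := by
    conv_lhs => rw [← hpre]
    rw [← setLIntegral_map hrB hfm (measurable_const_smul r), hmap, Measure.restrict_smul,
      lintegral_smul_measure, finrank_euclideanSpace, Fintype.card_fin,
      abs_of_pos (by positivity), smul_eq_mul]
  have hscale : ∀ y, f (r • y) = ENNReal.ofReal (r ^ (d + 1))⁻¹ * f y := by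
    intro y
    simp only [hf]
    rw [← ENNReal.ofReal_mul (by positivity), norm_smul, Real.norm_of_nonneg hr.le, mul_pow]
    congr 1
    rw [one_div, one_div, mul_inv]
    ring
  simp_rw [hscale] at hchange
  rw [lintegral_const_mul _ hfm] at hchange
  rw [intensity_apply hrB, intensity_apply hB]
  have h1 : ENNReal.ofReal (r ^ d) * ENNReal.ofReal (r ^ d)⁻¹ = 1 := by
    rw [← ENNReal.ofReal_mul (by positivity), mul_inv_cancel₀ (by positivity), ENNReal.ofReal_one]
  calc ∫⁻ y in r • B, f y
      = ENNReal.ofReal (r ^ d) * (ENNReal.ofReal (r ^ d)⁻¹ * ∫⁻ y in r • B, f y) := by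
        rw [← mul_assoc, h1, one_mul]
    _ = ENNReal.ofReal r⁻¹ * ∫⁻ y in B, f y := by
        rw [← hchange, ← mul_assoc, ← ENNReal.ofReal_mul (by positivity)]
        congr 2
        field_simp
        ring

theorem intensity_ball_pos {d : ℕ} (u : EuclideanSpace ℝ (Fin d)) {r : ℝ} (hr : 0 < r)
    (hu : r ≤ ‖u‖) : 0 < intensity d (Metric.ball u r) := by
  have hA := sphereArea_pos (Nat.succ_pos d)
  rw [intensity_apply measurableSet_ball, setLIntegral_pos_iff (by fun_prop)]
  refine (Metric.measure_ball_pos volume u hr).trans_le (measure_mono fun y hy => ⟨?_, hy⟩)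
  have hy0 : 0 < ‖y‖ := by
    rw [norm_pos_iff]
    rintro rfl
    rw [Metric.mem_ball, dist_eq_norm, zero_sub, norm_neg] at hy
    linarith
  simp only [Function.mem_support, ne_eq, ENNReal.ofReal_eq_zero, not_le]
  positivity

end Intensity

section HalfSphere

variable {d : ℕ} {e : EuclideanSpace ℝ (Fin (d + 1))}

theorem toSphere_halfSphere (he : ‖e‖ = 1) :
    (volume : Measure (EuclideanSpace ℝ (Fin (d + 1)))).toSphere
      {x | 0 ≤ inner ℝ (x : EuclideanSpace ℝ (Fin (d + 1))) e} =
      ENNReal.ofReal (sphereArea (d + 1) / 2) := by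
  have he0 : e ≠ 0 := by rintro rfl; simp at he
  have h := two_mul_toSphere_halfSphere he0
  rw [toSphere_univ_eq_sphereArea] at h
  have hA := sphereArea_pos (Nat.succ_pos d)
  rw [ENNReal.ofReal_div_of_pos two_pos, ← h, ENNReal.ofReal_ofNat, mul_comm,
    ENNReal.mul_div_cancel_right two_ne_zero ENNReal.ofNat_ne_top]

theorem measurableSet_halfSphere (e : EuclideanSpace ℝ (Fin (d + 1))) :
    MeasurableSet {x : Metric.sphere (0 : EuclideanSpace ℝ (Fin (d + 1))) 1 |
      0 ≤ inner ℝ (x : EuclideanSpace ℝ (Fin (d + 1))) e} :=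
  (isClosed_le continuous_const (by fun_prop)).measurableSet

theorem isProbabilityMeasure_halfSphereUniform (he : ‖e‖ = 1) :
    IsProbabilityMeasure (halfSphereUniform e) := by
  refine cond_isProbabilityMeasure ?_
  rw [toSphere_halfSphere he]
  have hA := sphereArea_pos (Nat.succ_pos d)
  simpa using hA

theorem ae_halfSphereUniform_inner_pos (he : ‖e‖ = 1) :
    ∀ᵐ x : Metric.sphere (0 : EuclideanSpace ℝ (Fin (d + 1))) 1 ∂(halfSphereUniform e),
      0 < inner ℝ (x : EuclideanSpace ℝ (Fin (d + 1))) e := by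
  have he0 : e ≠ 0 := by rintro rfl; simp at he
  have h1 : ∀ᵐ x : Metric.sphere (0 : EuclideanSpace ℝ (Fin (d + 1))) 1 ∂(halfSphereUniform e),
      inner ℝ (x : EuclideanSpace ℝ (Fin (d + 1))) e ≠ 0 := by
    have h : ∀ᵐ x : Metric.sphere (0 : EuclideanSpace ℝ (Fin (d + 1))) 1 ∂volume.toSphere,
        inner ℝ (x : EuclideanSpace ℝ (Fin (d + 1))) e ≠ 0 := by
      rw [ae_iff]
      simpa using toSphere_equator he0
    exact cond_absolutelyContinuous.ae_le h
  filter_upwards [h1, ae_cond_mem (measurableSet_halfSphere e)] with x h2 h3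
  exact lt_of_le_of_ne h3 h2.symm

variable {A : EuclideanSpace ℝ (Fin d) →ₗᵢ[ℝ] EuclideanSpace ℝ (Fin (d + 1))}

/-- The law of the gnomonic projection divided by `s` is of beta-prime type. -/
theorem halfSphereUniform_gnomonic (he : ‖e‖ = 1) (hA : ∀ y, inner ℝ e (A y) = 0) {s : ℝ}
    (hs : 0 < s) {B : Set (EuclideanSpace ℝ (Fin d))} (hB : MeasurableSet B) :
    halfSphereUniform e {x | gnomonic e A s (x : EuclideanSpace ℝ (Fin (d + 1))) ∈ B} =
      ∫⁻ y in B, ENNReal.ofReal (2 / sphereArea (d + 1) *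
        (s ^ d / √(1 + s ^ 2 * ‖y‖ ^ 2) ^ (d + 1))) := by
  have hS := sphereArea_pos (Nat.succ_pos d)
  have h1 : halfSphereUniform e
      {x | gnomonic e A s (x : EuclideanSpace ℝ (Fin (d + 1))) ∈ B} =
      halfSphereUniform e {x | 0 < inner ℝ (x : EuclideanSpace ℝ (Fin (d + 1))) e ∧
        gnomonic e A s (x : EuclideanSpace ℝ (Fin (d + 1))) ∈ B} := by
    refine measure_congr ?_
    filter_upwards [ae_halfSphereUniform_inner_pos he] with x hx
    exact propext ⟨fun h => ⟨hx, h⟩, fun h => h.2⟩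
  rw [h1, halfSphereUniform, cond_apply (measurableSet_halfSphere e), toSphere_halfSphere he,
    Set.inter_eq_right.2 fun x hx => hx.1.le,
    toSphere_gnomonic_preimage he hA finrank_euclideanSpace_fin finrank_euclideanSpace_fin hs hB,
    ← ENNReal.ofReal_inv_of_pos (by positivity), ← lintegral_const_mul _ (by fun_prop)]
  refine lintegral_congr fun y => ?_
  rw [← ENNReal.ofReal_mul (by positivity), inv_div]

theorem div_sqrt_le_div_sqrt {a b r : ℝ} (ha : 0 ≤ a) (hab : a ≤ b) (hr : 0 ≤ r) :
    a / √(1 + a ^ 2 * r) ≤ b / √(1 + b ^ 2 * r) := by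
  have hb := ha.trans hab
  have h1 : 0 < 1 + a ^ 2 * r := by positivity
  have h2 : 0 < 1 + b ^ 2 * r := by positivity
  rw [div_le_div_iff₀ (Real.sqrt_pos.2 h1) (Real.sqrt_pos.2 h2)]
  refine (pow_le_pow_iff_left₀ (by positivity) (by positivity) two_ne_zero).1 ?_
  rw [mul_pow, mul_pow, Real.sq_sqrt h1.le, Real.sq_sqrt h2.le]
  have := pow_le_pow_left₀ ha hab 2
  nlinarith

theorem tendsto_div_sqrt {r : ℝ} (hr : 0 < r) :
    Tendsto (fun n : ℕ => (n : ℝ) / √(1 + (n : ℝ) ^ 2 * r ^ 2)) atTop (𝓝 (1 / r)) := by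
  have h1 : Tendsto (fun n : ℕ => 1 / √((1 / (n : ℝ)) ^ 2 + r ^ 2)) atTop (𝓝 (1 / r)) := by
    have h2 : Tendsto (fun n : ℕ => √((1 / (n : ℝ)) ^ 2 + r ^ 2)) atTop (𝓝 r) := by
      have := ((tendsto_one_div_atTop_nhds_zero_nat (𝕜 := ℝ)).pow 2).add_const (r ^ 2)
      have := (Real.continuous_sqrt.tendsto _).comp this
      simpa [Function.comp_def, Real.sqrt_sq hr.le] using this
    exact tendsto_const_nhds.div h2 hr.ne'
  refine h1.congr' ?_
  filter_upwards [eventually_gt_atTop 0] with n hn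
  have hn' : (0 : ℝ) < n := Nat.cast_pos.2 hn
  have h3 : 1 + (n : ℝ) ^ 2 * r ^ 2 = (n : ℝ) ^ 2 * ((1 / (n : ℝ)) ^ 2 + r ^ 2) := by
    field_simp
  rw [h3, Real.sqrt_mul (by positivity), Real.sqrt_sq hn'.le]
  field_simp

/-- The densities `2 / ω (n / √(1 + n² ‖y‖²)) ^ (d + 1)` of the expected number of rescaled
gnomonic projections increase to the density of the intensity measure. -/
theorem tendsto_mul_halfSphereUniform_gnomonic (hd : 1 ≤ d) (he : ‖e‖ = 1)
    (hA : ∀ y, inner ℝ e (A y) = 0) {B : Set (EuclideanSpace ℝ (Fin d))} (hB : MeasurableSet B) :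
    Tendsto (fun n : ℕ => (n : ℝ≥0∞) * halfSphereUniform e
      {x | gnomonic e A n (x : EuclideanSpace ℝ (Fin (d + 1))) ∈ B}) atTop
      (𝓝 (intensity d B)) := by
  have hS := sphereArea_pos (Nat.succ_pos d)
  have : Nonempty (Fin d) := ⟨⟨0, hd⟩⟩
  rw [intensity_apply hB]
  have hlim : Tendsto (fun n : ℕ => ∫⁻ y in B, ENNReal.ofReal (2 / sphereArea (d + 1) *
      ((n : ℝ) / √(1 + (n : ℝ) ^ 2 * ‖y‖ ^ 2)) ^ (d + 1))) atTop
      (𝓝 (∫⁻ y in B, ENNReal.ofReal (2 / sphereArea (d + 1) * (1 / ‖y‖ ^ (d + 1))))) := by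
    refine lintegral_tendsto_of_tendsto_of_monotone (fun n => by fun_prop) ?_ ?_
    · refine .of_forall fun y m n hmn => ENNReal.ofReal_le_ofReal ?_
      have := div_sqrt_le_div_sqrt (a := m) (b := n) (r := ‖y‖ ^ 2) (by positivity)
        (by exact_mod_cast hmn) (by positivity)
      gcongr
    · have h0 : ∀ᵐ y ∂(volume.restrict B), y ≠ (0 : EuclideanSpace ℝ (Fin d)) :=
        ae_restrict_of_ae (by simp [ae_iff])
      filter_upwards [h0] with y hy
      have h1 := ((tendsto_div_sqrt (norm_pos_iff.2 hy)).pow (d + 1)).const_mul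
        (2 / sphereArea (d + 1))
      rw [div_pow, one_pow] at h1
      exact ENNReal.tendsto_ofReal h1
  refine hlim.congr' ?_
  filter_upwards [eventually_gt_atTop 0] with n hn
  have hn' : (0 : ℝ) < n := Nat.cast_pos.2 hn
  rw [halfSphereUniform_gnomonic he hA hn' hB, ← lintegral_const_mul _ (by fun_prop)]
  refine lintegral_congr fun y => ?_
  rw [← ENNReal.ofReal_natCast, ← ENNReal.ofReal_mul hn'.le]
  congr 1
  rw [div_pow, pow_succ (n : ℝ) d]
  ring

end HalfSphere

end RandomCones

namespace RandomCones

/-! ### Polar sets of random point sets and their void probabilities -/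

section VoidProbabilities

variable {W : Type*} [NormedAddCommGroup W] [InnerProductSpace ℝ W]

/-- The points `x` with `⟨x, t⟩ > 1` for some `t ∈ J`: the polar set of `A` contains `J` if and only
if `A` has no point in this set. -/
def exceedanceSet (J : Set W) : Set W :=
  {x | ∃ t ∈ J, 1 < inner ℝ x t}

theorem subset_polarSet_iff {J A : Set W} : J ⊆ polarSet A ↔ A ∩ exceedanceSet J = ∅ := by
  simp only [Set.eq_empty_iff_forall_notMem, exceedanceSet, Set.mem_inter_iff,
    Set.mem_ofPred_eq, not_and, not_exists, not_lt]
  exact ⟨fun h x hx t ht => h ht x hx, fun h t ht x hx => h x hx t ht⟩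

theorem isOpen_exceedanceSet (J : Set W) : IsOpen (exceedanceSet J) := by
  have : exceedanceSet J = ⋃ t ∈ J, {x | 1 < inner ℝ x t} := by
    ext; simp [exceedanceSet]
  rw [this]
  exact isOpen_biUnion fun t _ => isOpen_lt continuous_const (by fun_prop)

theorem exceedanceSet_subset (J : Finset W) :
    ∃ ε : ℝ, 0 < ε ∧ exceedanceSet (J : Set W) ⊆ {x | ε ≤ ‖x‖} := by
  set c : ℝ := 1 + ∑ t ∈ J, ‖t‖ with hc
  have hc0 : 0 < c := by positivity
  refine ⟨c⁻¹, inv_pos.2 hc0, ?_⟩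
  rintro x ⟨t, ht, hxt⟩
  have h1 : ‖t‖ ≤ c := by
    have : ‖t‖ ≤ ∑ t ∈ J, ‖t‖ := Finset.single_le_sum (fun t _ => norm_nonneg t) ht
    linarith
  have h2 : 1 ≤ ‖x‖ * c :=
    hxt.le.trans ((real_inner_le_norm x t).trans (by gcongr))
  exact (inv_le_iff_one_le_mul₀ hc0).2 h2

theorem polarSet_mem_nhds_zero {A : Set W} (hA : Bornology.IsBounded A) : polarSet A ∈ 𝓝 0 := by
  obtain ⟨R, hR, hAR⟩ := hA.exists_pos_norm_le
  exact mem_of_superset (Metric.closedBall_mem_nhds 0 (inv_pos.2 hR))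
    (closedBall_subset_polarSet hR hAR)

theorem IsSqueezed.isBody_polarSet [FiniteDimensional ℝ W] {A : Set W} {ρ M : ℝ}
    (h : IsSqueezed ρ M (polarSet A)) : IsBody (polarSet A) :=
  IsBody.polarSet h.2

variable [MeasurableSpace W] [BorelSpace W] {Ω : Type*} [MeasurableSpace Ω] {μ : Measure Ω}
  {N : Ω → Set W}

theorem nullMeasurableSet_mem_of_eq_polarSet
    {K : Ω → Set W} (hN : ∀ B : Set W, MeasurableSet B → NullMeasurableSet {w | N w ∩ B = ∅} μ)
    (hK : ∀ᵐ w ∂μ, K w = polarSet (N w)) (t : W) : NullMeasurableSet {w | t ∈ K w} μ := by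
  refine (hN _ (isOpen_exceedanceSet {t}).measurableSet).congr ?_
  filter_upwards [hK] with w hw
  refine propext ?_
  change N w ∩ exceedanceSet {t} = ∅ ↔ t ∈ K w
  rw [← subset_polarSet_iff, Set.singleton_subset_iff, hw]

theorem real_not_isSqueezed_le [IsProbabilityMeasure μ]
    (hN : ∀ B : Set W, MeasurableSet B → NullMeasurableSet {w | N w ∩ B = ∅} μ)
    {R r : ℝ} (hR : 0 < R) (hr : 0 < r) (U : Finset W)
    (hU : Metric.sphere (0 : W) 1 ⊆ ⋃ u ∈ U, Metric.ball u (1 / 4)) :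
    μ.real {w | ¬ IsSqueezed R⁻¹ (2 / r) (polarSet (N w))} ≤
      (1 - μ.real {w | N w ∩ {x | R ≤ ‖x‖} = ∅}) +
        ∑ u ∈ U, μ.real {w | N w ∩ Metric.ball (r • u) (r / 4) = ∅} := by
  have hm : MeasurableSet {x : W | R ≤ ‖x‖} :=
    (isClosed_le continuous_const continuous_norm).measurableSet
  rw [← probReal_compl_eq_one_sub₀ (hN _ hm)]
  refine (measureReal_mono (μ := μ) (s₂ := {w | N w ∩ {x | R ≤ ‖x‖} = ∅}ᶜ ∪
    ⋃ u ∈ U, {w | N w ∩ Metric.ball (r • u) (r / 4) = ∅}) fun w hw => ?_).trans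
    ((measureReal_union_le _ _).trans (add_le_add le_rfl (measureReal_biUnion_finset_le _ _)))
  by_contra hcon
  simp only [Set.mem_union, Set.mem_compl_iff, Set.mem_ofPred_eq, not_or, not_not, Set.mem_iUnion,
    not_exists] at hcon
  refine hw ⟨closedBall_subset_polarSet hR fun x hx => ?_,
    polarSet_subset_closedBall hr (U := U) hU fun u hu =>
      Set.nonempty_iff_ne_empty.2 (hcon.2 u hu)⟩
  by_contra! hx'
  exact (Set.eq_empty_iff_forall_notMem.1 hcon.1) x ⟨hx, hx'.le⟩

end VoidProbabilities

section Conditioning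

variable {Ω : Type*} [MeasurableSpace Ω] {μ : Measure Ω}

theorem ae_cond_mem₀ {E : Set Ω} (hE : NullMeasurableSet E μ) : ∀ᵐ w ∂(cond μ E), w ∈ E := by
  have h : cond μ E ≪ μ.restrict E := Measure.smul_absolutelyContinuous
  exact h.ae_le (ae_restrict_mem₀ hE)

theorem cond_real_apply₀ {E : Set Ω} (hE : NullMeasurableSet E μ) (A : Set Ω) :
    (cond μ E).real A = (μ.real E)⁻¹ * μ.real (A ∩ E) := by
  rw [measureReal_def, ProbabilityTheory.cond, Measure.smul_apply, Measure.restrict_apply₀' hE, smul_eq_mul,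
    ENNReal.toReal_mul, ENNReal.toReal_inv, measureReal_def, measureReal_def]

theorem tendsto_cond_real {Ω : ℕ → Type*} [∀ n, MeasurableSpace (Ω n)]
    {P : ∀ n, Measure (Ω n)} [∀ n, IsProbabilityMeasure (P n)] {E A : ∀ n, Set (Ω n)} {a : ℝ}
    (hE : ∀ᶠ n in atTop, NullMeasurableSet (E n) (P n))
    (hE1 : Tendsto (fun n => (P n).real (E n)) atTop (𝓝 1))
    (hA : Tendsto (fun n => (P n).real (A n)) atTop (𝓝 a)) :
    Tendsto (fun n => (cond (P n) (E n)).real (A n)) atTop (𝓝 a) := by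
  have h1 : Tendsto (fun n => (P n).real (A n ∩ E n)) atTop (𝓝 a) := by
    have hlow : Tendsto (fun n => (P n).real (A n) - (1 - (P n).real (E n))) atTop (𝓝 a) := by
      simpa using hA.sub (hE1.const_sub 1)
    refine tendsto_of_tendsto_of_tendsto_of_le_of_le' hlow hA ?_
      (.of_forall fun n => measureReal_mono Set.inter_subset_left)
    filter_upwards [hE] with n hn
    have := measureReal_union_le (μ := P n) (A n ∩ E n) (A n \ E n)
    rw [Set.inter_union_sdiff] at this
    have h2 : (P n).real (A n \ E n) ≤ (P n).real (E n)ᶜ := measureReal_mono fun w hw => hw.2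
    rw [probReal_compl_eq_one_sub₀ hn] at h2
    linarith
  have h2 := (hE1.inv₀ one_ne_zero).mul h1
  rw [inv_one, one_mul] at h2
  refine h2.congr' ?_
  filter_upwards [hE] with n hn
  rw [cond_real_apply₀ hn]

end Conditioning

section PolarSets

variable {W : Type*} [NormedAddCommGroup W] [InnerProductSpace ℝ W] [FiniteDimensional ℝ W]
  [MeasurableSpace W] [BorelSpace W] {Ω : Type*} [MeasurableSpace Ω] {μ : Measure Ω}
  {N K : Ω → Set W}

theorem nullMeasurableSet_isBody_of_eq_polarSet
    (hN : ∀ B : Set W, MeasurableSet B → NullMeasurableSet {w | N w ∩ B = ∅} μ)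
    (hK : ∀ᵐ w ∂μ, K w = polarSet (N w) ∧ Bornology.IsBounded (N w)) :
    NullMeasurableSet {w | IsBody (K w)} μ := by
  refine nullMeasurableSet_isBody
    (nullMeasurableSet_mem_of_eq_polarSet hN (hK.mono fun _ hw => hw.1)) ?_
  filter_upwards [hK] with w ⟨hw, hb⟩
  rw [hw]
  exact ⟨convex_polarSet _, isClosed_polarSet _, polarSet_mem_nhds_zero hb⟩

theorem ae_cond_isBody_of_eq_polarSet
    (hN : ∀ B : Set W, MeasurableSet B → NullMeasurableSet {w | N w ∩ B = ∅} μ)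
    (hK : ∀ᵐ w ∂μ, K w = polarSet (N w) ∧ Bornology.IsBounded (N w)) :
    ∀ᵐ w ∂(cond μ {w | IsBody (K w)}), IsBody (K w) ∧ K w ∈ 𝓝 0 := by
  filter_upwards [ae_cond_mem₀ (nullMeasurableSet_isBody_of_eq_polarSet hN hK),
    cond_absolutelyContinuous.ae_le hK] with w h1 ⟨h2, h3⟩
  exact ⟨h1, h2 ▸ polarSet_mem_nhds_zero h3⟩

theorem aemeasurable_toBody_cond_of_eq_polarSet
    (hN : ∀ B : Set W, MeasurableSet B → NullMeasurableSet {w | N w ∩ B = ∅} μ)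
    (hK : ∀ᵐ w ∂μ, K w = polarSet (N w) ∧ Bornology.IsBounded (N w)) :
    AEMeasurable (fun w => toBody (K w)) (cond μ {w | IsBody (K w)}) :=
  aemeasurable_toBody (fun t => (nullMeasurableSet_mem_of_eq_polarSet hN
    (hK.mono fun _ hw => hw.1) t).mono_ac cond_absolutelyContinuous)
    (ae_cond_isBody_of_eq_polarSet hN hK)

end PolarSets

/-! ### Convergence of polar sets from convergence of void probabilities -/

section Limit

variable {d : ℕ}

/-- Radii for which the bound `real_not_isSqueezed_le` is small when the void probability of `B` is
`exp (-Λ B)`: the intensity of the complement of a large ball is small by homogeneity, and that of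
each of the balls `B(r u, r / 4)` tends to infinity as `r → 0`. -/
theorem exists_tight_radii (d : ℕ) {ε : ℝ} (hε : 0 < ε) :
    ∃ (R r : ℝ) (U : Finset (EuclideanSpace ℝ (Fin d))), 0 < R ∧ 0 < r ∧
      Metric.sphere (0 : EuclideanSpace ℝ (Fin d)) 1 ⊆ ⋃ u ∈ U, Metric.ball u (1 / 4) ∧
      (∀ u ∈ U, intensity d (Metric.ball (r • u) (r / 4)) ≠ ∞) ∧
      (1 - Real.exp (-(intensity d {x | R ≤ ‖x‖}).toReal)) +
        ∑ u ∈ U, Real.exp (-(intensity d (Metric.ball (r • u) (r / 4))).toReal) < ε := by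
  obtain ⟨U, hU1, hUf, hU⟩ := (isCompact_sphere (0 : EuclideanSpace ℝ (Fin d)) 1).finite_cover_balls
    (show (0 : ℝ) < 1 / 4 by norm_num)
  obtain ⟨U, rfl⟩ := hUf.exists_finset_coe
  have hm : MeasurableSet {x : EuclideanSpace ℝ (Fin d) | (1 : ℝ) ≤ ‖x‖} :=
    (isClosed_le continuous_const continuous_norm).measurableSet
  have hR : ∀ R : ℝ, 0 < R → (intensity d {x | R ≤ ‖x‖}).toReal =
      R⁻¹ * (intensity d {x | (1 : ℝ) ≤ ‖x‖}).toReal := by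
    intro R hR
    have : {x : EuclideanSpace ℝ (Fin d) | R ≤ ‖x‖} =
        R • {x : EuclideanSpace ℝ (Fin d) | (1 : ℝ) ≤ ‖x‖} := by
      ext x
      rw [Set.mem_smul_set_iff_inv_smul_mem₀ hR.ne', Set.mem_ofPred_eq, Set.mem_ofPred_eq,
        norm_smul, norm_inv, Real.norm_of_nonneg hR.le, inv_mul_eq_div, one_le_div hR]
    rw [this, intensity_smul hR hm, ENNReal.toReal_mul, ENNReal.toReal_ofReal (by positivity)]
  have hscale : ∀ r : ℝ, 0 < r → ∀ u : EuclideanSpace ℝ (Fin d),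
      intensity d (Metric.ball (r • u) (r / 4)) =
        ENNReal.ofReal r⁻¹ * intensity d (Metric.ball u (1 / 4)) := by
    intro r hr u
    rw [← intensity_smul hr measurableSet_ball, smul_ball hr.ne', Real.norm_of_nonneg hr.le,
      mul_one_div]
  have hfin : ∀ u ∈ U, intensity d (Metric.ball u (1 / 4)) ≠ ∞ := by
    intro u hu
    refine ((measure_mono fun x hx => ?_).trans_lt
      (intensity_lt_top (d := d) (ε := 1 / 2) (by norm_num))).ne
    have h1 : ‖u‖ = 1 := mem_sphere_zero_iff_norm.1 (hU1 hu)
    rw [Metric.mem_ball, dist_eq_norm] at hx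
    have h2 := norm_sub_norm_le u x
    rw [norm_sub_rev] at h2
    change (1 / 2 : ℝ) ≤ ‖x‖
    linarith
  have hpos : ∀ u ∈ U, 0 < (intensity d (Metric.ball u (1 / 4))).toReal := fun u hu =>
    ENNReal.toReal_pos (intensity_ball_pos u (by norm_num)
      (by rw [mem_sphere_zero_iff_norm.1 (hU1 hu)]; norm_num)).ne' (hfin u hu)
  have hlimR : Tendsto (fun R : ℝ => 1 - Real.exp (-(intensity d {x | R ≤ ‖x‖}).toReal)) atTop
      (𝓝 0) := by
    have h1 : Tendsto (fun R : ℝ => 1 - Real.exp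
        (-(R⁻¹ * (intensity d {x | (1 : ℝ) ≤ ‖x‖}).toReal))) atTop (𝓝 (1 - Real.exp (-(0 *
        (intensity d {x | (1 : ℝ) ≤ ‖x‖}).toReal)))) :=
      ((Real.continuous_exp.tendsto _).comp
        (tendsto_inv_atTop_zero.mul_const _).neg).const_sub 1
    rw [zero_mul, neg_zero, Real.exp_zero, sub_self] at h1
    refine h1.congr' ?_
    filter_upwards [eventually_gt_atTop 0] with R hR0
    rw [hR R hR0]
  have hlimr : Tendsto (fun r : ℝ => ∑ u ∈ U,
      Real.exp (-(intensity d (Metric.ball (r • u) (r / 4))).toReal)) (𝓝[>] 0) (𝓝 0) := by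
    have h : ∀ u ∈ U, Tendsto (fun r : ℝ =>
        Real.exp (-(intensity d (Metric.ball (r • u) (r / 4))).toReal)) (𝓝[>] 0) (𝓝 0) := by
      intro u hu
      have h1 : Tendsto (fun r : ℝ => Real.exp
          (-(r⁻¹ * (intensity d (Metric.ball u (1 / 4))).toReal))) (𝓝[>] 0) (𝓝 0) :=
        Real.tendsto_exp_neg_atTop_nhds_zero.comp
          (tendsto_inv_nhdsGT_zero.atTop_mul_const (hpos u hu))
      refine h1.congr' ?_
      filter_upwards [self_mem_nhdsWithin] with r hr
      rw [hscale r hr, ENNReal.toReal_mul, ENNReal.toReal_ofReal (inv_nonneg.2 (le_of_lt hr))]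
    simpa using tendsto_finsetSum U h
  obtain ⟨R, hRε, hR0⟩ := ((hlimR.eventually_lt_const (half_pos hε)).and
    (eventually_gt_atTop 0)).exists
  obtain ⟨r, hrε, hr0⟩ := ((hlimr.eventually_lt_const (half_pos hε)).and
    self_mem_nhdsWithin).exists
  refine ⟨R, r, U, hR0, hr0, hU, fun u hu => ?_, by linarith⟩
  rw [hscale r hr0]
  exact ENNReal.mul_ne_top ENNReal.ofReal_ne_top (hfin u hu)

variable {Ω' : Type*} [MeasurableSpace Ω'] {P' : Measure Ω'} [IsProbabilityMeasure P']
  {N' : Ω' → Set (EuclideanSpace ℝ (Fin d))}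

theorem ae_isBody_polarSet_of_void
    (hN' : ∀ B, MeasurableSet B → NullMeasurableSet {w | N' w ∩ B = ∅} P')
    (hvoid' : ∀ B, MeasurableSet B → intensity d B ≠ ∞ →
      P'.real {w | N' w ∩ B = ∅} = Real.exp (-(intensity d B).toReal)) :
    ∀ᵐ w ∂P', IsBody (polarSet (N' w)) ∧ polarSet (N' w) ∈ 𝓝 0 := by
  rw [ae_iff, ← measureReal_eq_zero_iff]
  refine le_antisymm (le_of_forall_pos_le_add fun ε hε => ?_) measureReal_nonneg
  obtain ⟨R, r, U, hR, hr, hU, hfin, hlt⟩ := exists_tight_radii d hε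
  have hb := real_not_isSqueezed_le hN' hR hr U hU
  rw [hvoid' _ (isClosed_le continuous_const continuous_norm).measurableSet
    (intensity_lt_top hR).ne,
    Finset.sum_congr rfl fun u hu => hvoid' _ measurableSet_ball (hfin u hu)] at hb
  rw [zero_add]
  refine (measureReal_mono (s₂ := {w | ¬ IsSqueezed R⁻¹ (2 / r) (polarSet (N' w))}) ?_).trans
    (hb.trans hlt.le)
  refine fun w hw hsq => hw ⟨hsq.isBody_polarSet, ?_⟩
  exact mem_of_superset (Metric.closedBall_mem_nhds 0 (inv_pos.2 hR)) hsq.1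

/-- Convergence in distribution of the polar sets of random point sets, conditioned to be bodies, to
the polar set of a point set with void probabilities `exp (-Λ B)`, where `Λ` is `intensity d`. -/
theorem convergesWeakly_polarSet_of_void {Ω : ℕ → Type*} [∀ n, MeasurableSpace (Ω n)]
    {P : ∀ n, Measure (Ω n)} [∀ n, IsProbabilityMeasure (P n)]
    {N K : ∀ n, Ω n → Set (EuclideanSpace ℝ (Fin d))}
    (hN : ∀ n B, MeasurableSet B → NullMeasurableSet {w | N n w ∩ B = ∅} (P n))
    (hK : ∀ᶠ n in atTop, ∀ᵐ w ∂(P n), K n w = polarSet (N n w) ∧ Bornology.IsBounded (N n w))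
    (hvoid : ∀ B, MeasurableSet B → intensity d B ≠ ∞ →
      Tendsto (fun n => (P n).real {w | N n w ∩ B = ∅}) atTop
        (𝓝 (Real.exp (-(intensity d B).toReal))))
    (hN' : ∀ B, MeasurableSet B → NullMeasurableSet {w | N' w ∩ B = ∅} P')
    (hvoid' : ∀ B, MeasurableSet B → intensity d B ≠ ∞ →
      P'.real {w | N' w ∩ B = ∅} = Real.exp (-(intensity d B).toReal)) :
    ConvergesWeakly
      (fun n => Measure.map (fun w => toBody (K n w)) (cond (P n) {w | IsBody (K n w)}))
      (P'.map fun w => toBody (polarSet (N' w))) := by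
  have hEm : ∀ᶠ n in atTop, NullMeasurableSet {w | IsBody (K n w)} (P n) :=
    hK.mono fun n hn => nullMeasurableSet_isBody_of_eq_polarSet (hN n) hn
  have htight : ∀ ε : ℝ, 0 < ε → ∃ ρ M : ℝ, 0 < ρ ∧ 0 ≤ M ∧
      (∀ᶠ n in atTop, (P n).real {w | ¬ IsSqueezed ρ M (K n w)} ≤ ε) ∧
      P'.real {w | ¬ IsSqueezed ρ M (polarSet (N' w))} ≤ ε := by
    intro ε hε
    obtain ⟨R, r, U, hR, hr, hU, hfin, hlt⟩ := exists_tight_radii d hε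
    have hm : MeasurableSet {x : EuclideanSpace ℝ (Fin d) | R ≤ ‖x‖} :=
      (isClosed_le continuous_const continuous_norm).measurableSet
    refine ⟨R⁻¹, 2 / r, inv_pos.2 hR, by positivity, ?_, ?_⟩
    · have hlim := ((hvoid _ hm (intensity_lt_top hR).ne).const_sub 1).add
        (tendsto_finsetSum U fun u hu => hvoid _ measurableSet_ball (hfin u hu))
      filter_upwards [hlim.eventually_lt_const hlt, hK] with n h1 h2
      refine le_trans ?_ ((real_not_isSqueezed_le (hN n) hR hr U hU).trans h1.le)
      refine (measureReal_congr ?_).le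
      filter_upwards [h2] with w hw
      refine propext ?_
      change ¬ IsSqueezed _ _ (K n w) ↔ ¬ IsSqueezed _ _ (polarSet (N n w))
      rw [hw.1]
    · have hb := real_not_isSqueezed_le hN' hR hr U hU
      rw [hvoid' _ hm (intensity_lt_top hR).ne,
        Finset.sum_congr rfl fun u hu => hvoid' _ measurableSet_ball (hfin u hu)] at hb
      exact hb.trans hlt.le
  have hE1 : Tendsto (fun n => (P n).real {w | IsBody (K n w)}) atTop (𝓝 1) := by
    rw [tendsto_order]
    refine ⟨fun a ha => ?_, fun a ha => .of_forall fun n => measureReal_le_one.trans_lt ha⟩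
    obtain ⟨ρ, M, -, -, h1, -⟩ := htight ((1 - a) / 2) (by linarith)
    filter_upwards [h1, hK, hEm] with n h2 h3 h4
    have h5 : (P n).real {w | IsBody (K n w)}ᶜ ≤
        (P n).real {w | ¬ IsSqueezed ρ M (K n w)} := by
      refine ENNReal.toReal_mono (measure_ne_top _ _) (measure_mono_ae ?_)
      filter_upwards [h3] with w ⟨hw, _⟩ hwn hsq
      refine hwn ?_
      change IsBody (K n w)
      rw [hw] at hsq ⊢
      exact hsq.isBody_polarSet
    rw [probReal_compl_eq_one_sub₀ h4] at h5
    linarith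
  refine convergesWeakly_toBody ?_ inferInstance ?_
    (nullMeasurableSet_mem_of_eq_polarSet hN' (.of_forall fun _ => rfl))
    (hK.mono fun n hn => ae_cond_isBody_of_eq_polarSet (hN n) hn)
    (ae_isBody_polarSet_of_void hN' hvoid') (fun J => ?_) fun ε hε => ?_
  · filter_upwards [hE1.eventually_const_lt one_half_lt_one] with n hn
    refine cond_isProbabilityMeasure fun h0 => ?_
    rw [measureReal_def, h0, ENNReal.toReal_zero] at hn
    norm_num at hn
  · exact hK.mono fun n hn t => (nullMeasurableSet_mem_of_eq_polarSet (hN n)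
      (hn.mono fun _ hw => hw.1) t).mono_ac cond_absolutelyContinuous
  · refine tendsto_cond_real hEm hE1 ?_
    obtain ⟨δ, hδ, hJ⟩ := exceedanceSet_subset J
    have hJfin : intensity d (exceedanceSet (J : Set (EuclideanSpace ℝ (Fin d)))) ≠ ∞ :=
      ((measure_mono hJ).trans_lt (intensity_lt_top hδ)).ne
    have hJm := (isOpen_exceedanceSet (J : Set (EuclideanSpace ℝ (Fin d)))).measurableSet
    simp_rw [subset_polarSet_iff]
    rw [hvoid' _ hJm hJfin]
    refine (hvoid _ hJm hJfin).congr' ?_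
    filter_upwards [hK] with n hn
    refine measureReal_congr ?_
    filter_upwards [hn] with w hw
    refine propext ?_
    change N n w ∩ exceedanceSet _ = ∅ ↔ (J : Set (EuclideanSpace ℝ (Fin d))) ⊆ K n w
    rw [hw.1, subset_polarSet_iff]
  · obtain ⟨ρ, M, hρ, hM, h1, h2⟩ := htight (ε / 2) (half_pos hε)
    refine ⟨ρ, M, hρ, hM, ?_, h2.trans (by linarith)⟩
    filter_upwards [h1, hEm, hE1.eventually_const_lt one_half_lt_one] with n h3 h4 h5
    rw [cond_real_apply₀ h4]
    calc ((P n).real {w | IsBody (K n w)})⁻¹ *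
          (P n).real ({w | ¬ IsSqueezed ρ M (K n w)} ∩ {w | IsBody (K n w)})
        ≤ (1 / 2)⁻¹ * (ε / 2) := by
          gcongr
          exact (measureReal_mono Set.inter_subset_left).trans h3
      _ = ε := by ring

end Limit

/-! ### Void probabilities of the Poisson process and of the sample -/

section Voids

theorem IsPoissonPointProcess.nullMeasurableSet_void {Ω S : Type*} [MeasurableSpace Ω]
    [MeasurableSpace S] {N : Ω → Set S} {Λ : Measure S} {P : Measure Ω}
    (hN : IsPoissonPointProcess N Λ P) (B : Set S) (hB : MeasurableSet B) :
    NullMeasurableSet {w | N w ∩ B = ∅} P := by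
  have h := (hN.aemeasurable B hB).nullMeasurableSet_preimage (measurableSet_singleton 0)
  have : (fun w => (N w ∩ B).encard) ⁻¹' {0} = {w | N w ∩ B = ∅} := by
    ext w; simp
  rwa [this] at h

theorem IsPoissonPointProcess.real_void {Ω S : Type*} [MeasurableSpace Ω]
    [MeasurableSpace S] {N : Ω → Set S} {Λ : Measure S} {P : Measure Ω}
    (hN : IsPoissonPointProcess N Λ P) (B : Set S) (hB : MeasurableSet B) (hΛ : Λ B ≠ ∞) :
    P.real {w | N w ∩ B = ∅} = Real.exp (-(Λ B).toReal) := by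
  have h := hN.law B hB hΛ 0
  have h0 : {w | (N w ∩ B).encard = (0 : ℕ)} = {w | N w ∩ B = ∅} := by ext w; simp
  rw [h0, poissonMeasure_singleton] at h
  rw [measureReal_def, h, ENNReal.toReal_ofReal (by positivity)]
  simp [ENNReal.coe_toNNReal_eq_toReal]

variable {Ω S : Type*} [MeasurableSpace Ω] [MeasurableSpace S] {P : Measure Ω} {ν : Measure S}
  {n : ℕ} {X : Fin n → Ω → S}

theorem nullMeasurableSet_sample_void (hX : ∀ i, HasLaw (X i) ν P) {D : Set S}
    (hD : MeasurableSet D) : NullMeasurableSet {w | ∀ i, X i w ∉ D} P := by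
  have : {w | ∀ i, X i w ∉ D} = ⋂ i, X i ⁻¹' Dᶜ := by ext; simp
  rw [this]
  exact .iInter fun i => (hX i).aemeasurable.nullMeasurableSet_preimage hD.compl

theorem real_sample_void [IsProbabilityMeasure ν] (hX : ∀ i, HasLaw (X i) ν P)
    (hind : iIndepFun X P) {D : Set S} (hD : MeasurableSet D) :
    P.real {w | ∀ i, X i w ∉ D} = (1 - ν.real D) ^ n := by
  have h1 : {w | ∀ i, X i w ∉ D} = ⋂ i ∈ (Finset.univ : Finset (Fin n)), X i ⁻¹' Dᶜ := by
    ext; simp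
  have h2 : ∀ i, P (X i ⁻¹' Dᶜ) = ν Dᶜ := fun i => by
    rw [← (hX i).map_eq, Measure.map_apply_of_aemeasurable (hX i).aemeasurable hD.compl]
  rw [measureReal_def, h1, hind.measure_inter_preimage_eq_mul Finset.univ fun i _ => hD.compl]
  simp_rw [h2]
  rw [Finset.prod_const, Finset.card_univ, Fintype.card_fin, ENNReal.toReal_pow,
    ← measureReal_def, probReal_compl_eq_one_sub hD]

end Voids

end RandomCones

namespace RandomCones

/-! ### The section of the cell by the tangent space -/

section Sample

variable {d : ℕ} {e : EuclideanSpace ℝ (Fin (d + 1))}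
  {I : tangentPlane (-e) ≃ᵢ EuclideanSpace ℝ (Fin d)}
  {A : EuclideanSpace ℝ (Fin d) →ₗᵢ[ℝ] EuclideanSpace ℝ (Fin (d + 1))}
  {Ω : Type*} {n : ℕ} {X : Fin n → Ω → Metric.sphere (0 : EuclideanSpace ℝ (Fin (d + 1))) 1}

theorem range_gnomonic_inter_eq_empty_iff {B : Set (EuclideanSpace ℝ (Fin d))} (w : Ω) :
    (Set.range fun i => gnomonic e A n (X i w : EuclideanSpace ℝ (Fin (d + 1)))) ∩ B = ∅ ↔
      ∀ i, X i w ∉ {x : Metric.sphere (0 : EuclideanSpace ℝ (Fin (d + 1))) 1 |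
        gnomonic e A n (x : EuclideanSpace ℝ (Fin (d + 1))) ∈ B} := by
  simp [Set.eq_empty_iff_forall_notMem]

variable [MeasurableSpace Ω] {P : Measure Ω}

theorem ae_forall_inner_pos (he : ‖e‖ = 1) (hX : ∀ i, HasLaw (X i) (halfSphereUniform e) P) :
    ∀ᵐ w ∂P, ∀ i, 0 < inner ℝ (X i w : EuclideanSpace ℝ (Fin (d + 1))) e := by
  refine ae_all_iff.2 fun i => ?_
  have h := ae_halfSphereUniform_inner_pos he
  rw [← (hX i).map_eq] at h
  exact ae_of_ae_map (hX i).aemeasurable h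

theorem ae_eq_polarCone (he : ‖e‖ = 1) (hX : ∀ i, HasLaw (X i) (halfSphereUniform e) P)
    {S : Ω → Set (EuclideanSpace ℝ (Fin (d + 1)))}
    (hS : ∀ᵐ w ∂P, S w ∈ tessellation (fun i => (X i w : EuclideanSpace ℝ (Fin (d + 1)))) ∧
      -e ∈ S w) :
    ∀ᵐ w ∂P, S w = polarCone (PointedCone.hull ℝ
      (Set.range fun i => (X i w : EuclideanSpace ℝ (Fin (d + 1)))) :
        Set (EuclideanSpace ℝ (Fin (d + 1)))) := by
  filter_upwards [hS, ae_forall_inner_pos he hX] with w h1 h2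
  exact tessellation_cell_eq_polarCone _ e h2 h1.1 h1.2

theorem ae_rescaledProfile_eq_polarSet (he : ‖e‖ = 1)
    (hA : ∀ y, (I.symm y : EuclideanSpace ℝ (Fin (d + 1))) = -e + A y) (hn : n ≠ 0)
    (hX : ∀ i, HasLaw (X i) (halfSphereUniform e) P)
    {S : Ω → Set (EuclideanSpace ℝ (Fin (d + 1)))}
    (hS : ∀ᵐ w ∂P, S w ∈ tessellation (fun i => (X i w : EuclideanSpace ℝ (Fin (d + 1)))) ∧
      -e ∈ S w) :
    ∀ᵐ w ∂P, rescaledProfile n I (S w) = polarSet (Set.range fun i =>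
        gnomonic e A n (X i w : EuclideanSpace ℝ (Fin (d + 1)))) ∧
      Bornology.IsBounded (Set.range fun i =>
        gnomonic e A n (X i w : EuclideanSpace ℝ (Fin (d + 1)))) := by
  filter_upwards [ae_eq_polarCone he hX hS, ae_forall_inner_pos he hX] with w h1 h2
  rw [h1]
  exact ⟨rescaledProfile_polarCone_eq_polarSet hA hn _ h2, (Set.finite_range _).isBounded⟩

theorem measurableSet_gnomonic_mem {s : ℝ} {B : Set (EuclideanSpace ℝ (Fin d))}
    (hB : MeasurableSet B) :
    MeasurableSet {x : Metric.sphere (0 : EuclideanSpace ℝ (Fin (d + 1))) 1 |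
      gnomonic e A s (x : EuclideanSpace ℝ (Fin (d + 1))) ∈ B} :=
  ((measurable_gnomonic e A s).comp measurable_subtype_coe) hB

theorem nullMeasurableSet_range_gnomonic_void (hX : ∀ i, HasLaw (X i) (halfSphereUniform e) P)
    (B : Set (EuclideanSpace ℝ (Fin d))) (hB : MeasurableSet B) :
    NullMeasurableSet {w | (Set.range fun i =>
      gnomonic e A n (X i w : EuclideanSpace ℝ (Fin (d + 1)))) ∩ B = ∅} P := by
  simp_rw [range_gnomonic_inter_eq_empty_iff]
  exact nullMeasurableSet_sample_void hX (measurableSet_gnomonic_mem hB)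

/-- The Poisson limit theorem for the void probabilities `(1 - p) ^ n` of the rescaled gnomonic
projections of the sample. -/
theorem tendsto_real_range_gnomonic_void (hd : 1 ≤ d) (he : ‖e‖ = 1)
    (hA : ∀ y, inner ℝ e (A y) = 0) {Ω : ℕ → Type*} [∀ n, MeasurableSpace (Ω n)]
    {P : ∀ n, Measure (Ω n)}
    {X : ∀ n, Fin n → Ω n → Metric.sphere (0 : EuclideanSpace ℝ (Fin (d + 1))) 1}
    (hX : ∀ n i, HasLaw (X n i) (halfSphereUniform e) (P n))
    (hind : ∀ n, iIndepFun (X n) (P n))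
    (B : Set (EuclideanSpace ℝ (Fin d))) (hB : MeasurableSet B) (hΛ : intensity d B ≠ ∞) :
    Tendsto (fun n => (P n).real {w | (Set.range fun i =>
      gnomonic e A n (X n i w : EuclideanSpace ℝ (Fin (d + 1)))) ∩ B = ∅}) atTop
      (𝓝 (Real.exp (-(intensity d B).toReal))) := by
  have := isProbabilityMeasure_halfSphereUniform he
  have h1 := (ENNReal.tendsto_toReal hΛ).comp
    (tendsto_mul_halfSphereUniform_gnomonic hd he hA hB)
  refine (Real.tendsto_one_add_pow_exp_of_tendsto (g := fun n : ℕ => -(halfSphereUniform e).real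
    {x | gnomonic e A n (x : EuclideanSpace ℝ (Fin (d + 1))) ∈ B})
    (h1.neg.congr fun n => ?_)).congr fun n => ?_
  · simp [measureReal_def]
  · simp_rw [range_gnomonic_inter_eq_empty_iff]
    rw [real_sample_void (hX n) (hind n) (measurableSet_gnomonic_mem hB), sub_eq_add_neg]

end Sample

end RandomCones

theorem corollary4p2 (d : ℕ) (hd : 1 ≤ d)
    -- the north pole, and the isometry from the tangent space at the south pole to `ℝ^d`
    (e : EuclideanSpace ℝ (Fin (d + 1))) (he : ‖e‖ = 1)
    (I : RandomCones.tangentPlane (-e) ≃ᵢ EuclideanSpace ℝ (Fin d))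
    (hI : I ⟨-e, RandomCones.self_mem_tangentPlane (-e)⟩ = 0)
    -- for each `n`, independent uniform points `X 1, …, X n` on the upper half-sphere
    (Ω : ℕ → Type*) [∀ n, MeasurableSpace (Ω n)]
    (P : ∀ n, Measure (Ω n)) [∀ n, IsProbabilityMeasure (P n)]
    (X : ∀ n, Fin n → Ω n → Metric.sphere (0 : EuclideanSpace ℝ (Fin (d + 1))) 1)
    (hXlaw : ∀ n i, HasLaw (X n i) (RandomCones.halfSphereUniform e) (P n))
    (hXindep : ∀ n, iIndepFun (X n) (P n))
    -- the (almost surely unique) cell of the hyperplane tessellation containing the south pole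
    (S : ∀ n, Ω n → Set (EuclideanSpace ℝ (Fin (d + 1))))
    (hS : ∀ n, ∀ᵐ w ∂(P n),
      S n w ∈ RandomCones.tessellation
        (fun i => (X n i w : EuclideanSpace ℝ (Fin (d + 1)))) ∧ -e ∈ S n w)
    -- the Poisson point process
    (Ω' : Type*) [MeasurableSpace Ω'] (P' : Measure Ω') [IsProbabilityMeasure P']
    (N : Ω' → Set (EuclideanSpace ℝ (Fin d)))
    (hN : RandomCones.IsPoissonPointProcess N (RandomCones.intensity d) P') :
    -- `S n` is almost surely the polar cone of `R_n = pos(X 1, …, X n)`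
    (∀ n, ∀ᵐ w ∂(P n), S n w = RandomCones.polarCone
      (PointedCone.hull ℝ
        (Set.range fun i => (X n i w : EuclideanSpace ℝ (Fin (d + 1)))) :
          Set (EuclideanSpace ℝ (Fin (d + 1))))) ∧
    -- the event of compactness is an event, and the bodies involved are random elements
    (∀ n, NullMeasurableSet
      {w | RandomCones.IsBody (RandomCones.rescaledProfile n I (S n w))} (P n)) ∧
    (∀ n, AEMeasurable
      (fun w => RandomCones.toBody (RandomCones.rescaledProfile n I (S n w)))
      (ProbabilityTheory.cond (P n)
        {w | RandomCones.IsBody (RandomCones.rescaledProfile n I (S n w))})) ∧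
    (∀ᵐ w ∂P', RandomCones.IsBody (RandomCones.polarSet (convexHull ℝ (N w)))) ∧
    AEMeasurable
      (fun w => RandomCones.toBody (RandomCones.polarSet (convexHull ℝ (N w)))) P' ∧
    -- weak convergence of the conditional laws
    RandomCones.ConvergesWeakly
      (fun n => Measure.map
        (fun w => RandomCones.toBody (RandomCones.rescaledProfile n I (S n w)))
        (ProbabilityTheory.cond (P n)
          {w | RandomCones.IsBody (RandomCones.rescaledProfile n I (S n w))}))
      (Measure.map
        (fun w => RandomCones.toBody (RandomCones.polarSet (convexHull ℝ (N w)))) P') := by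
  obtain ⟨A, hA, hAe⟩ := RandomCones.exists_linearIsometry_of_tangentPlane I hI
  have hvoidm := fun n =>
    RandomCones.nullMeasurableSet_range_gnomonic_void (A := A) (hXlaw n)
  have hK := fun n (hn : n ≠ 0) =>
    RandomCones.ae_rescaledProfile_eq_polarSet he hA hn (hXlaw n) (hS n)
  -- for `n = 0` the section is scaled by the factor `0`
  have hK0 : ∀ᵐ w ∂(P 0), RandomCones.rescaledProfile 0 I (S 0 w) = {0} :=
    (hS 0).mono fun w hw => RandomCones.rescaledProfile_zero I hw.2
  have hbody0 : RandomCones.IsBody ({0} : Set (EuclideanSpace ℝ (Fin d))) :=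
    ⟨convex_singleton 0, isCompact_singleton, Set.singleton_nonempty 0⟩
  simp_rw [RandomCones.polarSet_convexHull]
  have hN' := RandomCones.ae_isBody_polarSet_of_void hN.nullMeasurableSet_void hN.real_void
  refine ⟨fun n => RandomCones.ae_eq_polarCone he (hXlaw n) (hS n), fun n => ?_, fun n => ?_,
    hN'.mono fun _ hw => hw.1, ?_, ?_⟩
  · rcases eq_or_ne n 0 with rfl | hn
    · refine (MeasurableSet.univ.nullMeasurableSet (μ := P 0)).congr ?_
      filter_upwards [hK0] with w hw
      refine propext ⟨fun _ => ?_, fun _ => trivial⟩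
      change RandomCones.IsBody (RandomCones.rescaledProfile 0 I (S 0 w))
      rwa [hw]
    · exact RandomCones.nullMeasurableSet_isBody_of_eq_polarSet (hvoidm n) (hK n hn)
  · rcases eq_or_ne n 0 with rfl | hn
    · refine (aemeasurable_const (b := RandomCones.toBody {0})).congr ?_
      filter_upwards [cond_absolutelyContinuous.ae_le hK0] with w hw
      rw [hw]
    · exact RandomCones.aemeasurable_toBody_cond_of_eq_polarSet (hvoidm n) (hK n hn)
  · exact RandomCones.aemeasurable_toBody (RandomCones.nullMeasurableSet_mem_of_eq_polarSet
      hN.nullMeasurableSet_void (.of_forall fun _ => rfl)) hN'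
  · exact RandomCones.convergesWeakly_polarSet_of_void hvoidm
      ((eventually_ne_atTop 0).mono hK)
      (RandomCones.tendsto_real_range_gnomonic_void hd he hAe hXlaw hXindep)
      hN.nullMeasurableSet_void hN.real_void
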